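/- Let $\Lambda\subset\mathbb R^m$ and let $\mathcal X_\lambda=P(x,y;\lambda)\partial_x+Q(x,y;\lambda)\partial_y$, $\lambda\in\Lambda$, be a family of real planar vector fields, analytic in $(x,y,\lambda)$ near every $(0,0,\lambda)$, $\lambda\in\Lambda$. Let $p,q\ge 1$ be coprime integers which, for every $\lambda\in\Lambda$, are the weights of an edge of the Newton diagram of $\mathcal X_\lambda$, and suppose that the $(p,q)$-quasihomogeneous expansion is $\mathcal X_\lambda=\mathcal X_{r,\lambda}+\mathcal X_{r+1,\lambda}+\cdots$ with $r\ge1$ (where $\mathcal X_{j}=P_{p+j}\partial_x+Q_{q+j}\partial_y$, and $f_k$ denotes the sum of the Taylor monomials $c_{ij}x^iy^j$ of $f$ at the origin with $pi+qj=k$). Suppose that $\mathcal X_\lambda$ is in the monodromic class $\mathrm{Mo}^{(p,q)}$, that is, the origin is a monodromic singularity of the leading part $\mathcal X_{r,\lambda}$: it is a singular point, and every orbit starting close enough to it makes a complete turn around it while staying close to it. For every $\lambda\in\Lambda$ let $F_\lambda=0$ be an analytic invariant curve of $\mathcal X_\lambda$ through the origin: $F_\lambda\not\equiv0$ is real analytic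 near the origin, $F_\lambda(0,0)=0$ and $\mathcal X_\lambda(F_\lambda)=K_\lambda F_\lambda$ with an analytic cofactor $K_\lambda$. Suppose that $K_\lambda=K_{\bar r,\lambda}+K_{\bar r+1,\lambda}+\cdots$ is the $(p,q)$-quasihomogeneous expansion of the cofactor, with $\bar r\ge r$ not depending on $\lambda$ (the term $K_{\bar r,\lambda}$ may vanish for some $\lambda$). In the coordinates $x=\rho^p\cos\varphi$, $y=\rho^q\sin\varphi$, the orbits of $\mathcal X_\lambda$ near the origin are the solutions of an equation $d\rho/d\varphi=\mathcal F_\lambda(\varphi,\rho)$; let $\rho(\varphi;\rho_0)$ be the solution with $\rho(0;\rho_0)=\rho_0$. For all small $\rho_0>0$ the Poincaré map $\Pi_\lambda(\rho_0)=\rho(2\pi;\rho_0)$ is then defined and has a convergent expansion $\Pi_\lambda(\rho_0)=\sum_{i\ge1}\eta_i(\lambda)\rho_0^i$. Suppose that, for every $\lambda\in\Lambda$, the function $\varphi\mapsto K_{\bar r,\lambda}(\cos\varphi,\sin\varphi)$ is sign-defined, meaning that it is $\ge0$ for all $\varphi$ or $\le 0$ for all $\varphi$, and let $\hat\Lambda\subset\Lambda$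 be the set of those $\lambda$ for which it vanishes identically. Then: (i) if $\bar r=r$, then $\{\lambda\in\Lambda:\eta_1(\lambda)=1\}=\hat\Lambda$; (ii) if $\bar r>r$, then $\{\lambda\in\Lambda:\eta_{\bar r-r+1}(\lambda)=0\}=\hat\Lambda$. -/

import Mathlib

/-- The Taylor coefficient at the origin of the monomial `x ^ i * y ^ j` of a function of two real
variables, that is `∂ₓⁱ ∂ᵧʲ f (0, 0) / (i! j!)`. -/
noncomputable def taylorCoeff (f : ℝ × ℝ → ℝ) (i j : ℕ) : ℝ :=
  iteratedFDeriv ℝ (i + j) f (0, 0)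
      (fun k : Fin (i + j) => if (k : ℕ) < i then ((1, 0) : ℝ × ℝ) else (0, 1)) /
    ((i.factorial : ℝ) * (j.factorial : ℝ))

/-- The `(p, q)`-quasihomogeneous part of degree `k` of `f`: the sum of all the Taylor monomials
`c_ij x ^ i y ^ j` with `p i + q j = k` (where `p, q ≥ 1`, so that `i, j ≤ k`). -/
noncomputable def qhPart (p q k : ℕ) (f : ℝ × ℝ → ℝ) (z : ℝ × ℝ) : ℝ :=
  ∑ ij ∈ (Finset.range (k + 1) ×ˢ Finset.range (k + 1)).filter
      (fun ij => p * ij.1 + q * ij.2 = k),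
    taylorCoeff f ij.1 ij.2 * z.1 ^ ij.1 * z.2 ^ ij.2

/-- The `(p, q)`-quasihomogeneous part of degree `j` of a planar vector field, namely
`P_{p+j} ∂ₓ + Q_{q+j} ∂ᵧ`. -/
noncomputable def qhField (p q j : ℕ) (X : ℝ × ℝ → ℝ × ℝ) (z : ℝ × ℝ) : ℝ × ℝ :=
  (qhPart p q (p + j) (fun w => (X w).1) z, qhPart p q (q + j) (fun w => (X w).2) z)

/-- The `(p, q)`-quasihomogeneous expansion of `X` has the form `X = X_r + X_{r+1} + ⋯`. -/
def StartsAtDegree (p q r : ℕ) (X : ℝ × ℝ → ℝ × ℝ) : Prop :=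
  (∀ k < p + r, ∀ z, qhPart p q k (fun w => (X w).1) z = 0) ∧
    (∀ k < q + r, ∀ z, qhPart p q k (fun w => (X w).2) z = 0)

/-- The support of the vector field `P ∂ₓ + Q ∂ᵧ`, where `P = ∑ a_ij x ^ i y ^ (j - 1)` and
`Q = ∑ b_ij x ^ (i - 1) y ^ j`: the set of `(i, j)` with `(a_ij, b_ij) ≠ (0, 0)`. -/
def fieldSupport (X : ℝ × ℝ → ℝ × ℝ) : Set (ℕ × ℕ) :=
  {ij | (1 ≤ ij.2 ∧ taylorCoeff (fun w => (X w).1) ij.1 (ij.2 - 1) ≠ 0) ∨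
    (1 ≤ ij.1 ∧ taylorCoeff (fun w => (X w).2) (ij.1 - 1) ij.2 ≠ 0)}

/-- The convex hull of the union of the quadrants `(i, j) + ℝ₊²` over the support. -/
def newtonPolyhedron (X : ℝ × ℝ → ℝ × ℝ) : Set (ℝ × ℝ) :=
  convexHull ℝ (⋃ ij ∈ fieldSupport X, {z : ℝ × ℝ | (ij.1 : ℝ) ≤ z.1 ∧ (ij.2 : ℝ) ≤ z.2})

/-- The weights of the bounded edges of the Newton diagram: coprime positive integers `(p, q)` such
that the face of the Newton polyhedron on which `p i + q j` is minimal is a nondegenerate segment.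
The tangent of the angle between this segment and the ordinate axis is `q / p`. -/
def newtonWeights (X : ℝ × ℝ → ℝ × ℝ) : Set (ℕ × ℕ) :=
  {w | 0 < w.1 ∧ 0 < w.2 ∧ Nat.Coprime w.1 w.2 ∧
    ∃ u ∈ newtonPolyhedron X, ∃ v ∈ newtonPolyhedron X, u ≠ v ∧
      ∀ z ∈ newtonPolyhedron X,
        (w.1 : ℝ) * u.1 + (w.2 : ℝ) * u.2 ≤ (w.1 : ℝ) * z.1 + (w.2 : ℝ) * z.2 ∧
        (w.1 : ℝ) * v.1 + (w.2 : ℝ) * v.2 ≤ (w.1 : ℝ) * z.1 + (w.2 : ℝ) * z.2}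

/-- The origin is a monodromic singularity of `X`: it is a singular point and the local flow turns
around it. Given a neighbourhood of the origin, every solution that starts close enough to the
origin (but not at it) stays in this neighbourhood while it makes a complete turn around the origin.
The solution is written in polar form, with a positive radius `ϱ` and a continuous angle `θ`. -/
def IsMonodromic (X : ℝ × ℝ → ℝ × ℝ) : Prop :=
  X (0, 0) = (0, 0) ∧
    ∀ ε > 0, ∃ δ > 0, ∀ z₀ : ℝ × ℝ, z₀ ≠ (0, 0) → ‖z₀‖ < δ →
      ∃ T > 0, ∃ ϱ θ : ℝ → ℝ, ∃ γ : ℝ → ℝ × ℝ,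
        γ 0 = z₀ ∧ ContinuousOn θ (Set.Icc 0 T) ∧
        (∀ t ∈ Set.Icc 0 T,
          0 < ϱ t ∧ γ t = (ϱ t * Real.cos (θ t), ϱ t * Real.sin (θ t)) ∧ ‖γ t‖ < ε ∧
          HasDerivWithinAt γ (X (γ t)) (Set.Icc 0 T) t) ∧
        |θ T - θ 0| = 2 * Real.pi

/-- `X = X_r + ⋯` is in the monodromic class `Mo^(p, q)`: the weights `(p, q)` belong to the Newton
diagram of `X`, the `(p, q)`-quasihomogeneous expansion of `X` starts at degree `r`, and the origin
is a monodromic singularity of the leading part `X_r`. -/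
structure InMonodromicClass (p q r : ℕ) (X : ℝ × ℝ → ℝ × ℝ) : Prop where
  weights : (p, q) ∈ newtonWeights X
  expansion : StartsAtDegree p q r X
  monodromic : IsMonodromic (qhField p q r X)

/-- `F = 0` is an analytic invariant curve of `X` through the origin with analytic cofactor `K`:
`F` is not the zero germ, `F (0, 0) = 0`, and `X(F) = K F` near the origin. -/
structure IsInvariantCurve (X : ℝ × ℝ → ℝ × ℝ) (F K : ℝ × ℝ → ℝ) : Prop where
  analytic_curve : AnalyticAt ℝ F (0, 0)
  analytic_cofactor : AnalyticAt ℝ K (0, 0)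
  through_origin : F (0, 0) = 0
  nonzero : ¬ ∀ᶠ z in nhds ((0, 0) : ℝ × ℝ), F z = 0
  invariant : ∀ᶠ z in nhds ((0, 0) : ℝ × ℝ), fderiv ℝ F z (X z) = K z * F z

/-- The weighted polar blow-up `(x, y) = (ρ ^ p cos φ, ρ ^ q sin φ)`. -/
noncomputable def blowUp (p q : ℕ) (φ ρ : ℝ) : ℝ × ℝ :=
  (ρ ^ p * Real.cos φ, ρ ^ q * Real.sin φ)

/-- For `ρ > 0`, the radial component `R(φ, ρ) = ∑_{j ≥ r} ρ ^ (j - r + 1) F_j(φ)` of `X` in weighted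
polar coordinates, after division by the common factor `ρ ^ r / D(φ)`, where
`F_j(φ) = P_{p+j}(cos φ, sin φ) cos φ + Q_{q+j}(cos φ, sin φ) sin φ` and
`D(φ) = p cos² φ + q sin² φ`. -/
noncomputable def polarR (p q r : ℕ) (X : ℝ × ℝ → ℝ × ℝ) (φ ρ : ℝ) : ℝ :=
  ρ / ρ ^ r * ((X (blowUp p q φ ρ)).1 / ρ ^ p * Real.cos φ +
    (X (blowUp p q φ ρ)).2 / ρ ^ q * Real.sin φ)

/-- For `ρ > 0`, the angular component `Θ(φ, ρ) = ∑_{j ≥ r} ρ ^ (j - r) G_j(φ)` of `X` in weighted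
polar coordinates, after division by the common factor `ρ ^ r / D(φ)`, where
`G_j(φ) = p Q_{q+j}(cos φ, sin φ) cos φ - q P_{p+j}(cos φ, sin φ) sin φ`. -/
noncomputable def polarTheta (p q r : ℕ) (X : ℝ × ℝ → ℝ × ℝ) (φ ρ : ℝ) : ℝ :=
  1 / ρ ^ r * (p * ((X (blowUp p q φ ρ)).2 / ρ ^ q) * Real.cos φ -
    q * ((X (blowUp p q φ ρ)).1 / ρ ^ p) * Real.sin φ)

/-- `ρ₁` is the value at `ρ₀` of the Poincaré map: the solution of the Cauchy problem
`dρ/dφ = R(φ, ρ) / Θ(φ, ρ)`, `ρ(0) = ρ₀`, exists and is positive on `[0, 2π]`, and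
`ρ(2π) = ρ₁`. -/
def IsPoincareReturn (p q r : ℕ) (X : ℝ × ℝ → ℝ × ℝ) (ρ₀ ρ₁ : ℝ) : Prop :=
  ∃ u : ℝ → ℝ, u 0 = ρ₀ ∧ u (2 * Real.pi) = ρ₁ ∧
    ∀ φ ∈ Set.Icc 0 (2 * Real.pi),
      0 < u φ ∧ polarTheta p q r X φ (u φ) ≠ 0 ∧
      HasDerivWithinAt u (polarR p q r X φ (u φ) / polarTheta p q r X φ (u φ))
        (Set.Icc 0 (2 * Real.pi)) φ

/-- The Poincaré map is defined for all small `ρ₀ > 0` and is there the sum of the convergent power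
series `Π(ρ₀) = ∑_{i ≥ 1} η_i ρ₀ ^ i`; the value `η 0` plays no role. -/
def HasPoincareExpansion (p q r : ℕ) (X : ℝ × ℝ → ℝ × ℝ) (η : ℕ → ℝ) : Prop :=
  ∃ ε > 0, ∀ ρ₀ ∈ Set.Ioo 0 ε, ∃ ρ₁, IsPoincareReturn p q r X ρ₀ ρ₁ ∧
    HasSum (fun i : ℕ => η (i + 1) * ρ₀ ^ (i + 1)) ρ₁

/-- `f(cos φ, sin φ)` does not change sign on the circle (it may have zeros). -/
def SignDefinedOnCircle (f : ℝ × ℝ → ℝ) : Prop :=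
  (∀ φ : ℝ, 0 ≤ f (Real.cos φ, Real.sin φ)) ∨ (∀ φ : ℝ, f (Real.cos φ, Real.sin φ) ≤ 0)

open Filter Topology

/-! Put `n = rbar - r`. In weighted polar coordinates an orbit is a solution `u` of `dρ/dφ = R/Θ`,
and along it the invariance of the curve `F = 0` becomes a scalar linear equation in `φ`. Hence
after one turn `F` is multiplied by `exp L`, where `L` is the integral over `[0, 2π]` of `D(φ) K /
(u^r Θ)` (`exists_invariantCurve_along_solution`). The integrand is `u^n f(φ) + O(u^(n+1))` with `f
= D K_rbar / G_r`. Monodromy of the leading part excludes zeros of `G_r`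
(`angular_ne_zero_of_isMonodromic`), so `f` is continuous and inherits a constant sign from
`K_rbar`. Since `u` stays comparable to its initial value `ρ`, no cancellation is possible: `|L|`
has exact order `ρ^n` if `K_rbar` is not identically zero on the circle, and is `O(ρ^(n+1))`
otherwise (`exists_integral_polarCofactor_bounds`).

On the section `φ = 0` the function `h(ρ) = F(ρ^p, 0)` satisfies `h(Π(ρ)) = h(ρ) exp L`. It is not
identically zero, since otherwise `F` would vanish along all nearby orbits and hence near the
origin. It vanishes at `0` to a finite order `k ≥ 1`, so its logarithmic derivative behaves like
`k/ρ`, and `|L|` is comparable to `|Π(ρ) - ρ| / ρ` (`exists_displacement_bounds`). The order of `L`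
therefore decides whether the coefficient of `ρ^(n+1)` in `Π(ρ) - ρ` is zero. This coefficient is
`η_1 - 1` for `n = 0` and `η_(n+1)` for `n > 0`.

That `Π` has a convergent expansion at all is proved separately, by the analytic inverse function
theorem in the Banach algebra `C([0, 2π])` (`exists_hasPoincareExpansion`). -/

/-! ### Taylor coefficients and quasihomogeneous expansions in weighted polar coordinates. -/

/-- Symmetry of the iterated derivative: for analytic `f` it is a sum over all permutations of the
arguments, and a permutation `σ` carrying the first `i` slots onto `s` only reindexes that sum. -/
theorem iteratedFDeriv_piecewise_eq_taylorCoeff {f : ℝ × ℝ → ℝ} (hf : AnalyticAt ℝ f (0, 0)) {n : ℕ}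
    (s : Finset (Fin n)) :
    iteratedFDeriv ℝ n f (0, 0) (s.piecewise (fun _ => ((1, 0) : ℝ × ℝ)) (fun _ => (0, 1))) =
      (s.card.factorial : ℝ) * ((n - s.card).factorial : ℝ) *
        taylorCoeff f s.card (n - s.card) := by
  have hs : s.card ≤ n := by simpa using s.card_le_univ
  obtain ⟨i, hi⟩ : ∃ i, s.card = i := ⟨_, rfl⟩
  obtain ⟨j, rfl⟩ := Nat.exists_eq_add_of_le (hi ▸ hs)
  rw [hi, Nat.add_sub_cancel_left, taylorCoeff, mul_div_cancel₀ _ (by positivity)]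
  obtain ⟨P, R, hP⟩ := hf
  obtain ⟨σ, hσ⟩ : ∃ σ : Equiv.Perm (Fin (i + j)), ∀ k, σ k ∈ s ↔ (k : ℕ) < i := by
    have hc : Fintype.card {k : Fin (i + j) // (k : ℕ) < i} = Fintype.card {k // k ∈ s} := by
      have : (Finset.univ.filter fun k : Fin (i + j) => (k : ℕ) < i) =
          Finset.univ.map (Fin.castAddEmb j) := by
        ext k
        simp only [Finset.mem_filter, Finset.mem_univ, true_and, Finset.mem_map]
        constructor
        · intro h
          exact ⟨⟨k, h⟩, by ext; simp⟩
        · rintro ⟨l, rfl⟩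
          simp
      rw [Fintype.card_subtype, this]
      simp [hi]
    refine ⟨(Fintype.equivOfCardEq hc).extendSubtype, fun k => ?_⟩
    constructor
    · intro h
      by_contra hk
      exact (Fintype.equivOfCardEq hc).extendSubtype_not_mem k hk h
    · intro h
      exact (Fintype.equivOfCardEq hc).extendSubtype_mem k h
  rw [hP.iteratedFDeriv_eq_sum_of_completeSpace, hP.iteratedFDeriv_eq_sum_of_completeSpace,
    ← Equiv.sum_comp (Equiv.mulLeft σ)]
  refine Finset.sum_congr rfl fun τ _ => ?_
  congr 1
  ext1 k
  simp only [Equiv.coe_mulLeft, Equiv.Perm.coe_mul, Function.comp_apply, Finset.piecewise, hσ]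

theorem iteratedFDeriv_diag_eq_sum_taylorCoeff {f : ℝ × ℝ → ℝ} (hf : AnalyticAt ℝ f (0, 0)) (n : ℕ)
    (x y : ℝ) :
    iteratedFDeriv ℝ n f (0, 0) (fun _ => (x, y)) =
      (n.factorial : ℝ) *
        ∑ i ∈ Finset.range (n + 1), taylorCoeff f i (n - i) * x ^ i * y ^ (n - i) := by
  have h1 : (fun _ : Fin n => ((x, y) : ℝ × ℝ)) = (fun _ => (x, 0)) + (fun _ => (0, y)) := by
    ext <;> simp
  rw [h1, ContinuousMultilinearMap.map_add_univ]
  have h2 : ∀ s : Finset (Fin n),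
      iteratedFDeriv ℝ n f (0, 0) (s.piecewise (fun _ => ((x, 0) : ℝ × ℝ)) (fun _ => (0, y))) =
      x ^ s.card * y ^ (n - s.card) * ((s.card.factorial : ℝ) * ((n - s.card).factorial : ℝ) *
        taylorCoeff f s.card (n - s.card)) := by
    intro s
    have h3 : (s.piecewise (fun _ => ((x, 0) : ℝ × ℝ)) (fun _ => (0, y))) = fun k =>
        (s.piecewise (fun _ => x) (fun _ => y)) k •
          (s.piecewise (fun _ => ((1, 0) : ℝ × ℝ)) (fun _ => (0, 1))) k := by
      ext k <;> by_cases hk : k ∈ s <;> simp [hk]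
    rw [h3, ContinuousMultilinearMap.map_smul_univ, iteratedFDeriv_piecewise_eq_taylorCoeff hf,
      Finset.prod_piecewise]
    simp [← Finset.compl_eq_univ_sdiff, Finset.card_compl]
  simp_rw [h2]
  have := Finset.sum_powerset_apply_card (fun i => x ^ i * y ^ (n - i) *
    ((i.factorial : ℝ) * ((n - i).factorial : ℝ) * taylorCoeff f i (n - i)))
    (x := (Finset.univ : Finset (Fin n)))
  simp only [Finset.powerset_univ, Finset.card_univ, Fintype.card_fin] at this
  rw [this, Finset.mul_sum]
  refine Finset.sum_congr rfl fun i hi => ?_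
  have hi' : i ≤ n := Nat.lt_succ_iff.mp (Finset.mem_range.mp hi)
  have h4 : (n.factorial : ℝ) = n.choose i * (i.factorial * (n - i).factorial) := by
    rw [← Nat.choose_mul_factorial_mul_factorial hi']
    push_cast
    ring
  rw [h4, nsmul_eq_mul]
  ring

/-- Writing the derivative as a sum over permutations bounds the coefficient by a binomial
coefficient times `‖P (i + j)‖`; the binomial costs at most `2 ^ (i + j)`. -/
theorem exists_abs_taylorCoeff_le {f : ℝ × ℝ → ℝ} (hf : AnalyticAt ℝ f (0, 0)) :
    ∃ C > 0, ∃ B ≥ 1, ∀ i j, |taylorCoeff f i j| ≤ C * B ^ (i + j) := by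
  obtain ⟨P, R, hP⟩ := hf
  obtain ⟨s, hs0, hsR⟩ := ENNReal.lt_iff_exists_nnreal_btwn.1 (hP.r_pos.trans_le hP.r_le)
  have hs0' : 0 < (s : ℝ) := by exact_mod_cast hs0
  obtain ⟨C, hC, hCb⟩ := P.norm_mul_pow_le_of_lt_radius hsR
  refine ⟨C, hC, max 1 (2 / s), le_max_left _ _, fun i j => ?_⟩
  have hP' : ‖P (i + j)‖ ≤ C * (1 / s) ^ (i + j) := by
    rw [one_div, inv_pow, ← div_eq_mul_inv, le_div_iff₀ (by positivity)]
    exact hCb _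
  have h1 : |taylorCoeff f i j| ≤ ((i + j).factorial : ℝ) * ‖P (i + j)‖ /
      ((i.factorial : ℝ) * (j.factorial : ℝ)) := by
    rw [taylorCoeff, abs_div, abs_of_pos (show 0 < (i.factorial : ℝ) * (j.factorial : ℝ) by
      positivity), hP.iteratedFDeriv_eq_sum_of_completeSpace]
    gcongr
    refine (Finset.abs_sum_le_sum_abs _ _).trans ?_
    refine (Finset.sum_le_card_nsmul _ _ ‖P (i + j)‖ fun σ _ => ?_).trans ?_
    · rw [← Real.norm_eq_abs]
      refine ((P (i + j)).le_opNorm _).trans ?_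
      refine mul_le_of_le_one_right (norm_nonneg _) (Finset.prod_le_one (fun _ _ => norm_nonneg _) ?_)
      intro k _
      split_ifs <;> simp [Prod.norm_def]
    · simp [Fintype.card_perm]
  refine h1.trans ?_
  have h2 : ((i + j).factorial : ℝ) = (i + j).choose i * (i.factorial * j.factorial) := by
    have := Nat.choose_mul_factorial_mul_factorial (Nat.le_add_right i j)
    rw [Nat.add_sub_cancel_left] at this
    rw [← this]
    push_cast
    ring
  have h3 : (((i + j).choose i : ℕ) : ℝ) ≤ 2 ^ (i + j) := by
    exact_mod_cast Nat.choose_le_two_pow _ _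
  calc ((i + j).factorial : ℝ) * ‖P (i + j)‖ / ((i.factorial : ℝ) * (j.factorial : ℝ))
      = ((i + j).choose i : ℝ) * ‖P (i + j)‖ := by
        rw [h2]; field_simp
    _ ≤ 2 ^ (i + j) * (C * (1 / s) ^ (i + j)) := by gcongr
    _ = C * (2 / s) ^ (i + j) := by
        rw [div_eq_mul_one_div 2 (s : ℝ), mul_pow]; ring
    _ ≤ C * max 1 (2 / s) ^ (i + j) := by
        gcongr
        exact le_max_right _ _

theorem qhPart_one_one (f : ℝ × ℝ → ℝ) (n : ℕ) (z : ℝ × ℝ) :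
    qhPart 1 1 n f z =
      ∑ i ∈ Finset.range (n + 1), taylorCoeff f i (n - i) * z.1 ^ i * z.2 ^ (n - i) := by
  rw [← Finset.Nat.sum_antidiagonal_eq_sum_range_succ
    (fun i j => taylorCoeff f i j * z.1 ^ i * z.2 ^ j), qhPart]
  refine Finset.sum_congr ?_ fun _ _ => rfl
  ext ⟨i, j⟩
  rw [Finset.HasAntidiagonal.mem_antidiagonal]
  simp only [Finset.mem_filter, Finset.mem_product, Finset.mem_range]
  omega

theorem hasSum_qhPart_of_hasSum {p q : ℕ} (hp : 0 < p) (hq : 0 < q) {f : ℝ × ℝ → ℝ} {z : ℝ × ℝ}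
    {a : ℝ} (h : HasSum (fun ij : ℕ × ℕ => taylorCoeff f ij.1 ij.2 * z.1 ^ ij.1 * z.2 ^ ij.2) a) :
    HasSum (fun k => qhPart p q k f z) a := by
  convert! h.tsum_fiberwise (fun ij : ℕ × ℕ => p * ij.1 + q * ij.2) using 2 with k
  have hs : (fun ij : ℕ × ℕ => p * ij.1 + q * ij.2) ⁻¹' {k} =
      (((Finset.range (k + 1) ×ˢ Finset.range (k + 1)).filter
        (fun ij => p * ij.1 + q * ij.2 = k) : Finset (ℕ × ℕ)) : Set (ℕ × ℕ)) := by
    ext ⟨i, j⟩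
    simp only [Set.mem_preimage, Set.mem_singleton_iff, Finset.coe_filter, Finset.mem_product,
      Finset.mem_range, Set.mem_ofPred_eq]
    refine ⟨fun h => ⟨⟨?_, ?_⟩, h⟩, fun h => h.2⟩ <;> nlinarith
  rw [hs, Finset.tsum_subtype' _
    (fun ij : ℕ × ℕ => taylorCoeff f ij.1 ij.2 * z.1 ^ ij.1 * z.2 ^ ij.2), qhPart]

/-- The geometric bound makes the double series absolutely summable. Its sum is identified by
regrouping with weights `(1, 1)`, which gives the Taylor series by total degree. -/
theorem exists_hasSum_taylorCoeff {f : ℝ × ℝ → ℝ} (hf : AnalyticAt ℝ f (0, 0)) :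
    ∃ ε > 0, ∀ x y : ℝ, |x| < ε → |y| < ε →
      HasSum (fun ij : ℕ × ℕ => taylorCoeff f ij.1 ij.2 * x ^ ij.1 * y ^ ij.2) (f (x, y)) := by
  obtain ⟨C, hC, B, hB, hCB⟩ := exists_abs_taylorCoeff_le hf
  obtain ⟨P, R, hP⟩ := id hf
  obtain ⟨s, hs0, hsR⟩ := ENNReal.lt_iff_exists_nnreal_btwn.1 hP.r_pos
  have hs0' : 0 < (s : ℝ) := by exact_mod_cast hs0
  refine ⟨min s (1 / (2 * B)), by positivity, fun x y hx hy => ?_⟩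
  have hxB : |x| * B ≤ 1 / 2 := by
    have := (hx.trans_le (min_le_right _ _)).le
    rw [le_div_iff₀ (by positivity)] at this
    linarith
  have hyB : |y| * B ≤ 1 / 2 := by
    have := (hy.trans_le (min_le_right _ _)).le
    rw [le_div_iff₀ (by positivity)] at this
    linarith
  have hsum : Summable
      (fun ij : ℕ × ℕ => taylorCoeff f ij.1 ij.2 * x ^ ij.1 * y ^ ij.2) := by
    refine Summable.of_norm_bounded
      (g := fun ij : ℕ × ℕ => C * ((1 / 2 : ℝ) ^ ij.1 * (1 / 2 : ℝ) ^ ij.2)) ?_ ?_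
    · exact (summable_geometric_two.mul_of_nonneg summable_geometric_two
        (fun _ => by positivity) (fun _ => by positivity)).mul_left C
    · rintro ⟨i, j⟩
      simp only [norm_mul, norm_pow, Real.norm_eq_abs]
      calc |taylorCoeff f i j| * |x| ^ i * |y| ^ j
          ≤ C * B ^ (i + j) * |x| ^ i * |y| ^ j := by gcongr; exact hCB i j
        _ = C * ((|x| * B) ^ i * (|y| * B) ^ j) := by rw [pow_add, mul_pow, mul_pow]; ring
        _ ≤ _ := by gcongr
  have hz : ((x, y) : ℝ × ℝ) ∈ Metric.eball (0 : ℝ × ℝ) R := by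
    rw [Metric.mem_eball, edist_zero_right]
    refine lt_trans ?_ hsR
    rw [← ofReal_norm, ← ENNReal.ofReal_coe_nnreal,
      ENNReal.ofReal_lt_ofReal_iff hs0', Prod.norm_def]
    exact max_lt (hx.trans_le (min_le_left _ _)) (hy.trans_le (min_le_left _ _))
  have h1 := hP.hasSum_iteratedFDeriv hz
  have h2 := hasSum_qhPart_of_hasSum (z := (x, y)) one_pos one_pos hsum.hasSum
  have h3 : (fun n => ((n.factorial : ℝ))⁻¹ • iteratedFDeriv ℝ n f (0, 0) fun _ => (x, y)) =
      fun n => qhPart 1 1 n f (x, y) := by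
    ext n
    rw [iteratedFDeriv_diag_eq_sum_taylorCoeff hf, smul_eq_mul, inv_mul_cancel_left₀ (by positivity),
      qhPart_one_one]
  rw [h3] at h1
  have h4 := h1.unique h2
  rw [show ((0, 0) : ℝ × ℝ) + (x, y) = (x, y) by simp] at h4
  rw [h4]
  exact hsum.hasSum

theorem qhPart_blowUp (p q k : ℕ) (f : ℝ × ℝ → ℝ) (φ ρ : ℝ) :
    qhPart p q k f (blowUp p q φ ρ) = qhPart p q k f (Real.cos φ, Real.sin φ) * ρ ^ k := by
  rw [qhPart, qhPart, Finset.sum_mul]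
  refine Finset.sum_congr rfl fun ij hij => ?_
  rw [← (Finset.mem_filter.1 hij).2, blowUp, pow_add, pow_mul, pow_mul, mul_pow, mul_pow]
  ring

theorem continuous_qhPart (p q k : ℕ) (f : ℝ × ℝ → ℝ) : Continuous (qhPart p q k f) := by
  unfold qhPart
  fun_prop

theorem contDiff_qhPart (p q k : ℕ) (f : ℝ × ℝ → ℝ) : ContDiff ℝ 1 (qhPart p q k f) := by
  unfold qhPart
  fun_prop

theorem abs_blowUp_le {p q : ℕ} (hp : 0 < p) (hq : 0 < q) {φ ρ : ℝ} (hρ : |ρ| ≤ 1) :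
    |(blowUp p q φ ρ).1| ≤ |ρ| ∧ |(blowUp p q φ ρ).2| ≤ |ρ| := by
  simp only [blowUp, abs_mul, abs_pow]
  constructor
  · calc |ρ| ^ p * |Real.cos φ| ≤ |ρ| ^ p * 1 := by gcongr; exact Real.abs_cos_le_one φ
      _ ≤ |ρ| := by rw [mul_one]; exact pow_le_of_le_one (abs_nonneg _) hρ hp.ne'
  · calc |ρ| ^ q * |Real.sin φ| ≤ |ρ| ^ q * 1 := by gcongr; exact Real.abs_sin_le_one φ
      _ ≤ |ρ| := by rw [mul_one]; exact pow_le_of_le_one (abs_nonneg _) hρ hq.ne'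

/-- An analytic function is, in weighted polar coordinates, the sum of a power series in `ρ` that
converges uniformly in `φ`. -/
theorem exists_hasSum_qhPart_blowUp {p q : ℕ} (hp : 0 < p) (hq : 0 < q) {f : ℝ × ℝ → ℝ}
    (hf : AnalyticAt ℝ f (0, 0)) :
    ∃ ε > 0, ∀ φ ρ : ℝ, |ρ| < ε →
      HasSum (fun k => qhPart p q k f (Real.cos φ, Real.sin φ) * ρ ^ k) (f (blowUp p q φ ρ)) := by
  obtain ⟨ε, hε, h⟩ := exists_hasSum_taylorCoeff hf
  refine ⟨min ε 1, by positivity, fun φ ρ hρ => ?_⟩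
  obtain ⟨h1, h2⟩ := abs_blowUp_le hp hq (φ := φ) (hρ.trans_le (min_le_right _ _)).le
  have hρ' := hρ.trans_le (min_le_left _ _)
  simp_rw [← qhPart_blowUp]
  exact hasSum_qhPart_of_hasSum hp hq (h _ _ (h1.trans_lt hρ') (h2.trans_lt hρ'))

/-- A sequence of functions that grows at most geometrically, uniformly in the argument. -/
def GeomBounded (a : ℕ → ℝ → ℝ) : Prop :=
  ∃ C > 0, ∃ B ≥ 1, ∀ k φ, |a k φ| ≤ C * B ^ k

theorem geomBounded_qhPart {p q : ℕ} (hp : 0 < p) (hq : 0 < q) {f : ℝ × ℝ → ℝ}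
    (hf : AnalyticAt ℝ f (0, 0)) :
    GeomBounded (fun k φ => qhPart p q k f (Real.cos φ, Real.sin φ)) := by
  obtain ⟨C, hC, B, hB, hCB⟩ := exists_abs_taylorCoeff_le hf
  refine ⟨C * (2 * 2), by positivity, 2 * B, by linarith, fun k φ => ?_⟩
  have hB2 : 1 ≤ 2 * B := by linarith
  have h1 : ∀ ij ∈ (Finset.range (k + 1) ×ˢ Finset.range (k + 1)).filter
      (fun ij : ℕ × ℕ => p * ij.1 + q * ij.2 = k),
      |taylorCoeff f ij.1 ij.2 * Real.cos φ ^ ij.1 * Real.sin φ ^ ij.2| ≤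
        C * (2 * B) ^ k * ((1 / 2 : ℝ) ^ ij.1 * (1 / 2 : ℝ) ^ ij.2) := by
    rintro ⟨i, j⟩ hij
    have hk : i + j ≤ k := by
      rw [← (Finset.mem_filter.1 hij).2]
      dsimp only
      nlinarith
    simp only [abs_mul, abs_pow]
    calc |taylorCoeff f i j| * |Real.cos φ| ^ i * |Real.sin φ| ^ j
        ≤ |taylorCoeff f i j| * 1 ^ i * 1 ^ j := by
          gcongr
          · exact Real.abs_cos_le_one φ
          · exact Real.abs_sin_le_one φ
      _ ≤ C * B ^ (i + j) := by simpa using hCB i j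
      -- Doubling `B` leaves a factor `2^(-i-j)`, so the number of monomials of weighted degree `k`
      -- does not enter the bound.
      _ = C * (2 * B) ^ (i + j) * ((1 / 2 : ℝ) ^ i * (1 / 2 : ℝ) ^ j) := by
          rw [← pow_add, mul_assoc, ← mul_pow]
          ring_nf
      _ ≤ _ := by gcongr
  simp only [qhPart]
  calc _ ≤ _ := (Finset.abs_sum_le_sum_abs _ _).trans (Finset.sum_le_sum h1)
    _ ≤ ∑ ij ∈ Finset.range (k + 1) ×ˢ Finset.range (k + 1),
        C * (2 * B) ^ k * ((1 / 2 : ℝ) ^ ij.1 * (1 / 2 : ℝ) ^ ij.2) :=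
      Finset.sum_le_sum_of_subset_of_nonneg (Finset.filter_subset _ _)
        fun _ _ _ => by positivity
    _ = C * (2 * B) ^ k * ((∑ i ∈ Finset.range (k + 1), (1 / 2 : ℝ) ^ i) *
        ∑ j ∈ Finset.range (k + 1), (1 / 2 : ℝ) ^ j) := by
      rw [← Finset.mul_sum, Finset.sum_mul_sum, Finset.sum_product]
    _ ≤ C * (2 * B) ^ k * (2 * 2) := by
      gcongr <;> exact sum_geometric_two_le _
    _ = _ := by ring

/-! ### Analytic dependence on the initial value, by power series in the algebra `C([0, T])`. -/

/-- Applied with `A = C([0, T])`: bounds on the coefficients that are uniform in `φ` turn a power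
series in `ρ` with coefficients depending on `φ` into an analytic map of the algebra. -/
theorem exists_analyticAt_hasSum_mul_pow {A : Type*} [NormedCommRing A] [NormedAlgebra ℝ A]
    [CompleteSpace A] (a : ℕ → A) {C B : ℝ} (hB : 0 < B) (h : ∀ k, ‖a k‖ ≤ C * B ^ k) :
    ∃ S : A → A, AnalyticAt ℝ S 0 ∧ S 0 = a 0 ∧
      ∀ᶠ u in 𝓝 0, HasSum (fun k => a k * u ^ k) (S u) := by
  let P : FormalMultilinearSeries ℝ A A := fun k =>
    (ContinuousLinearMap.mul ℝ A (a k)).compContinuousMultilinearMap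
      (ContinuousMultilinearMap.mkPiAlgebraFin ℝ k A)
  have hP : ∀ k, ‖P k‖ ≤ C * B ^ k * max 1 ‖(1 : A)‖ := by
    intro k
    refine (ContinuousLinearMap.norm_compContinuousMultilinearMap_le _ _).trans ?_
    gcongr
    · exact (norm_nonneg _).trans (h k)
    · exact (ContinuousLinearMap.opNorm_mul_apply_le ℝ A (a k)).trans (h k)
    · exact ContinuousMultilinearMap.norm_mkPiAlgebraFin_le
  have hr : 0 < P.radius := by
    have : ((Real.toNNReal B⁻¹ : NNReal) : ENNReal) ≤ P.radius := by
      refine P.le_radius_of_bound (C * max 1 ‖(1 : A)‖) fun k => ?_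
      rw [Real.coe_toNNReal _ (by positivity)]
      calc ‖P k‖ * B⁻¹ ^ k ≤ C * B ^ k * max 1 ‖(1 : A)‖ * B⁻¹ ^ k := by gcongr; exact hP k
        _ = C * max 1 ‖(1 : A)‖ * (B * B⁻¹) ^ k := by rw [mul_pow]; ring
        _ = _ := by rw [mul_inv_cancel₀ hB.ne', one_pow, mul_one]
    refine lt_of_lt_of_le ?_ this
    simpa using hB
  have hS := P.hasFPowerSeriesOnBall hr
  have hPa : ∀ k u, P k (fun _ => u) = a k * u ^ k := fun k u => by
    simp [P, List.ofFn_const]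
  refine ⟨P.sum, hS.analyticAt, ?_, ?_⟩
  · have := hS.coeff_zero (fun _ => 0)
    rw [← this, hPa 0 0]
    simp
  · filter_upwards [Metric.eball_mem_nhds (0 : A) hr] with u hu
    have := hS.hasSum hu
    simpa only [hPa, zero_add] using this

/-- The Banach algebra of the continuous functions on `[0, T]`. -/
abbrev IccFun (T : ℝ) : Type := C(Set.Icc 0 T, ℝ)

section Volterra

variable {T : ℝ} (hT : 0 ≤ T)

/-- The integration operator `f ↦ ∫₀ᵗ f` on the continuous functions on `[0, T]`. -/
noncomputable def volterra : IccFun T →L[ℝ] IccFun T :=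
  LinearMap.mkContinuous
    { toFun := fun f => ⟨fun t => ∫ s in (0 : ℝ)..t, Set.IccExtend hT f s, by
        have h := intervalIntegral.continuous_primitive
          (μ := MeasureTheory.volume) (f := Set.IccExtend hT f)
          (fun a b => (f.continuous.Icc_extend' (h := hT)).intervalIntegrable a b) 0
        exact h.comp continuous_subtype_val⟩
      map_add' := fun f g => by
        ext t
        exact intervalIntegral.integral_add
          ((f.continuous.Icc_extend' (h := hT)).intervalIntegrable _ _)
          ((g.continuous.Icc_extend' (h := hT)).intervalIntegrable _ _)
      map_smul' := fun c f => by
        ext t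
        exact intervalIntegral.integral_const_mul c _ }
    T fun f => by
      rw [ContinuousMap.norm_le _ (by positivity)]
      intro t
      have h1 : ∀ s ∈ Set.uIoc (0 : ℝ) t, ‖Set.IccExtend hT f s‖ ≤ ‖f‖ := fun s _ =>
        f.norm_coe_le_norm _
      refine (intervalIntegral.norm_integral_le_of_norm_le_const h1).trans ?_
      rw [sub_zero, abs_of_nonneg t.2.1, mul_comm]
      gcongr
      exact t.2.2

theorem hasDerivAt_integral_IccExtend (f : IccFun T) (t : Set.Icc 0 T) :
    HasDerivAt (fun x : ℝ => ∫ s in (0 : ℝ)..x, Set.IccExtend hT f s) (f t) t := by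
  have := ((f.continuous.Icc_extend' (h := hT)).integral_hasStrictDerivAt 0 t).hasDerivAt
  rwa [Set.IccExtend_val] at this

/-- The local inverse of `w ↦ w - ∫₀ᵗ w (H(E w) - H(0))` at the constants. -/
theorem exists_analyticAt_volterra_solution {H : IccFun T → IccFun T}
    (hH : AnalyticAt ℝ H 0) (E : IccFun T) :
    ∃ w : ℝ → IccFun T, AnalyticAt ℝ w 0 ∧ w 0 = 0 ∧
      (∀ᶠ ρ in 𝓝 0, w ρ = volterra hT (w ρ * (H (E * w ρ) - H 0)) + algebraMap ℝ _ ρ) ∧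
      ∀ᶠ ρ in 𝓝[>] 0, ∀ t, 0 < w ρ t := by
  let K : IccFun T → IccFun T := fun w => H (E * w) - H 0
  have hK : AnalyticAt ℝ K 0 := by
    have h1 : AnalyticAt ℝ (fun w : (IccFun T) => E * w) 0 := by fun_prop
    have h2 : AnalyticAt ℝ H (E * 0) := by rwa [mul_zero]
    exact (h2.comp h1).sub analyticAt_const
  have hK0 : K 0 = 0 := by simp [K]
  let M : IccFun T → IccFun T := fun w => w * K w
  have hM : AnalyticAt ℝ M 0 := analyticAt_id.mul hK
  -- Both factors of `M` vanish at `0`, so its derivative there is zero and `Ψ` has derivative the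
  -- identity. This is what makes the inverse function theorem applicable without any smallness of
  -- `T`.
  have hM' : HasFDerivAt M (0 : IccFun T →L[ℝ] IccFun T) 0 := by
    have := (hasFDerivAt_id (𝕜 := ℝ) (0 : IccFun T)).mul hK.differentiableAt.hasFDerivAt
    convert! this using 1
    ext1 v
    simp [hK0]
  let Ψ : IccFun T → IccFun T := fun w => w - volterra hT (M w)
  have hΨ : AnalyticAt ℝ Ψ 0 :=
    analyticAt_id.sub (((volterra hT).analyticAt _).comp hM)
  have hΨ' : HasFDerivAt Ψ
      ((ContinuousLinearEquiv.refl ℝ (IccFun T) : IccFun T ≃L[ℝ] IccFun T) :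
        IccFun T →L[ℝ] IccFun T) 0 := by
    have := (hasFDerivAt_id (𝕜 := ℝ) (0 : IccFun T)).sub
      ((volterra hT).hasFDerivAt.comp (0 : IccFun T) hM')
    convert! this using 1
    ext1 v
    simp
  have hΨs : HasStrictFDerivAt Ψ
      ((ContinuousLinearEquiv.refl ℝ (IccFun T) : IccFun T ≃L[ℝ] IccFun T) : IccFun T →L[ℝ] IccFun T) 0 := by
    have := hΨ.hasStrictFDerivAt
    rwa [hΨ'.fderiv] at this
  have hΨ0 : Ψ 0 = 0 := by simp [Ψ, M]
  let R := hΨs.toOpenPartialHomeomorph Ψ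
  have hR0 : (0 : IccFun T) ∈ R.source := hΨs.mem_toOpenPartialHomeomorph_source
  have hRa : AnalyticAt ℝ R.symm (Ψ 0) := by
    obtain ⟨P, hP⟩ := hΨ
    refine (R.hasFPowerSeriesAt_symm (i := ContinuousLinearEquiv.refl ℝ (IccFun T)) hR0 hP ?_).analyticAt
    rw [← hΨ'.fderiv, hP.fderiv_eq]
    exact ((continuousMultilinearCurryFin1 ℝ (IccFun T) (IccFun T)).symm_apply_apply _).symm
  rw [hΨ0] at hRa
  have hRd : HasFDerivAt R.symm (ContinuousLinearMap.id ℝ (IccFun T)) 0 := by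
    have := hΨs.to_localInverse.hasFDerivAt
    rw [hΨ0] at this
    exact this
  have hcont : Tendsto (fun ρ : ℝ => algebraMap ℝ (IccFun T) ρ) (𝓝 0) (𝓝 0) := by
    have := (algebraMapCLM ℝ (IccFun T)).continuous.tendsto 0
    rwa [map_zero] at this
  refine ⟨fun ρ => R.symm (algebraMap ℝ (IccFun T) ρ), ?_, ?_, ?_, ?_⟩
  · have h1 : AnalyticAt ℝ (fun ρ : ℝ => algebraMap ℝ (IccFun T) ρ) 0 :=
      (algebraMapCLM ℝ (IccFun T)).analyticAt 0
    have h2 : AnalyticAt ℝ R.symm (algebraMap ℝ (IccFun T) 0) := by rwa [map_zero]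
    exact h2.comp h1
  · have := R.left_inv hR0
    rw [show R 0 = 0 from hΨ0] at this
    simpa using this
  · have h1 := hΨs.eventually_right_inverse
    rw [hΨ0] at h1
    filter_upwards [hcont.eventually h1] with ρ hρ
    have h2 : R.symm (algebraMap ℝ (IccFun T) ρ) -
        volterra hT (M (R.symm (algebraMap ℝ (IccFun T) ρ))) = algebraMap ℝ (IccFun T) ρ := hρ
    exact sub_eq_iff_eq_add'.1 h2
  -- The inverse is tangent to the identity, so `w ρ` differs from the constant `ρ` by at most `ρ /
  -- 2` uniformly, hence is positive.
  · have h1 := hRd.isLittleO.def (show (0 : ℝ) < 1 / 2 by norm_num)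
    have h2 : R.symm 0 = 0 := by
      have := R.left_inv hR0
      rwa [show R 0 = 0 from hΨ0] at this
    filter_upwards [nhdsWithin_le_nhds (hcont.eventually h1), self_mem_nhdsWithin] with ρ hρ hρ0 t
    rw [Set.mem_Ioi] at hρ0
    have h3 := (ContinuousMap.norm_coe_le_norm _ t).trans hρ
    have h4 : ‖algebraMap ℝ (IccFun T) ρ - 0‖ ≤ ρ := by
      rw [sub_zero, ContinuousMap.norm_le _ hρ0.le]
      intro s
      rw [algebraMap_apply]
      simp [abs_of_pos hρ0]
    have h5 : |R.symm (algebraMap ℝ (IccFun T) ρ) t - ρ| ≤ 1 / 2 * ρ := by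
      refine le_trans (le_of_eq ?_) (h3.trans (by gcongr))
      rw [← Real.norm_eq_abs]
      simp [h2, algebraMap_apply]
    have := (abs_le.1 h5).1
    change 0 < R.symm (algebraMap ℝ (IccFun T) ρ) t
    linarith

/-- The equation is `u' = u H(u)` with `H = Sa / Sb`. The substitution `u = E w`, `E = exp ∫ H(0)`,
removes the linear part and leaves `w' = w (H(E w) - H(0))`, whose integrated form with `w(0) = ρ`
is the Volterra equation solved above. Evaluation at `t` is a continuous algebra homomorphism, so it
turns series in the algebra into scalar series. -/
theorem exists_analyticAt_radial_solution (a b : ℕ → IccFun T) {C B C' B' : ℝ}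
    (hB : 0 < B) (ha : ∀ k, ‖a k‖ ≤ C * B ^ k) (hB' : 0 < B') (hb : ∀ k, ‖b k‖ ≤ C' * B' ^ k)
    (hb0 : ∀ t, b 0 t ≠ 0) {ε : ℝ} (hε : 0 < ε) :
    ∃ w : ℝ → IccFun T, AnalyticAt ℝ w 0 ∧ w 0 = 0 ∧
      ∀ᶠ ρ in 𝓝[>] 0, Set.IccExtend hT (w ρ) 0 = ρ ∧ ∀ t, 0 < w ρ t ∧ w ρ t < ε ∧
        ∃ N D, HasSum (fun k => a k t * w ρ t ^ k) N ∧ HasSum (fun k => b k t * w ρ t ^ k) D ∧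
          D ≠ 0 ∧ HasDerivWithinAt (Set.IccExtend hT (w ρ)) (w ρ t * N / D) (Set.Icc 0 T) t := by
  obtain ⟨Sa, hSa, hSa0, hSas⟩ := exists_analyticAt_hasSum_mul_pow a hB ha
  obtain ⟨Sb, hSb, hSb0, hSbs⟩ := exists_analyticAt_hasSum_mul_pow b hB' hb
  have hu : IsUnit (Sb 0) := by
    rw [hSb0, ContinuousMap.isUnit_iff_forall_ne_zero]
    exact hb0
  let H : IccFun T → IccFun T := fun u => Sa u * Ring.inverse (Sb u)
  have hH : AnalyticAt ℝ H 0 := by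
    have h1 : AnalyticAt ℝ Ring.inverse (Sb 0) := by
      obtain ⟨v, hv⟩ := hu
      rw [← hv]
      exact analyticAt_inverse v
    exact hSa.mul (h1.comp hSb)
  let E : IccFun T := ContinuousMap.comp ⟨Real.exp, Real.continuous_exp⟩ (volterra hT (H 0))
  obtain ⟨w, hwa, hw0, hws, hwp⟩ := exists_analyticAt_volterra_solution hT hH E
  have hEw : AnalyticAt ℝ (fun ρ => E * w ρ) 0 := analyticAt_const.mul hwa
  have hEw0 : Tendsto (fun ρ => E * w ρ) (𝓝 0) (𝓝 0) := by
    have := hEw.continuousAt.tendsto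
    rwa [hw0, mul_zero] at this
  have hunit : ∀ᶠ u in 𝓝 (0 : IccFun T), IsUnit (Sb u) :=
    hSb.continuousAt.eventually (by obtain ⟨v, hv⟩ := hu; rw [← hv]; exact Units.nhds v)
  have hsmall : ∀ᶠ u in 𝓝 (0 : IccFun T), ‖u‖ < ε := by
    filter_upwards [Metric.ball_mem_nhds (0 : IccFun T) hε] with u hu using by simpa using hu
  refine ⟨fun ρ => E * w ρ, hEw, by simp [hw0], ?_⟩
  filter_upwards [nhdsWithin_le_nhds hws, hwp, nhdsWithin_le_nhds (hEw0.eventually hunit),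
    nhdsWithin_le_nhds (hEw0.eventually hSas), nhdsWithin_le_nhds (hEw0.eventually hSbs),
    nhdsWithin_le_nhds (hEw0.eventually hsmall)]
    with ρ h1 h2 h3 h4 h5 h6
  set m : IccFun T := w ρ * (H (E * w ρ) - H 0) with hm
  have hwt : ∀ t : Set.Icc 0 T, w ρ t = (∫ s in (0 : ℝ)..t, Set.IccExtend hT m s) + ρ := by
    intro t
    conv_lhs => rw [h1]
    rfl
  have hEt : ∀ t : Set.Icc 0 T, E t = Real.exp (∫ s in (0 : ℝ)..t, Set.IccExtend hT (H 0) s) :=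
    fun t => rfl
  have hext : ∀ x ∈ Set.Icc 0 T, Set.IccExtend hT (E * w ρ) x =
      Real.exp (∫ s in (0 : ℝ)..x, Set.IccExtend hT (H 0) s) *
        ((∫ s in (0 : ℝ)..x, Set.IccExtend hT m s) + ρ) := by
    intro x hx
    rw [Set.IccExtend_of_mem hT _ hx, ContinuousMap.mul_apply, hwt, hEt]
  refine ⟨?_, fun t => ⟨?_, ?_, Sa (E * w ρ) t, Sb (E * w ρ) t, ?_, ?_, ?_, ?_⟩⟩
  · rw [hext 0 ⟨le_rfl, hT⟩]
    simp
  · rw [ContinuousMap.mul_apply, hEt]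
    exact mul_pos (Real.exp_pos _) (h2 t)
  · exact (le_abs_self _).trans_lt (((E * w ρ).norm_coe_le_norm t).trans_lt h6)
  · exact h4.map (ContinuousMap.evalCLM ℝ t) (ContinuousMap.evalCLM ℝ t).continuous
  · exact h5.map (ContinuousMap.evalCLM ℝ t) (ContinuousMap.evalCLM ℝ t).continuous
  · exact (ContinuousMap.isUnit_iff_forall_ne_zero _).1 h3 t
  · have hd := ((hasDerivAt_integral_IccExtend hT (H 0) t).exp.mul
      ((hasDerivAt_integral_IccExtend hT m t).add_const ρ)).hasDerivWithinAt (s := Set.Icc 0 T)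
    refine (hd.congr hext (hext t t.2)).congr_deriv ?_
    rw [← hwt, ← hEt, hm]
    have hHt : H (E * w ρ) t * Sb (E * w ρ) t = Sa (E * w ρ) t := by
      rw [← ContinuousMap.mul_apply, mul_assoc, Ring.inverse_mul_cancel _ h3, mul_one]
    rw [eq_div_iff ((ContinuousMap.isUnit_iff_forall_ne_zero _).1 h3 t), ← hHt]
    simp only [ContinuousMap.mul_apply, ContinuousMap.sub_apply]
    ring

end Volterra

/-! ### Monodromy of the leading part and nonvanishing of its angular component. -/

theorem qhField_blowUp (p q r : ℕ) (X : ℝ × ℝ → ℝ × ℝ) (φ ρ : ℝ) :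
    qhField p q r X (blowUp p q φ ρ) =
      ((qhField p q r X (Real.cos φ, Real.sin φ)).1 * ρ ^ (p + r),
        (qhField p q r X (Real.cos φ, Real.sin φ)).2 * ρ ^ (q + r)) := by
  simp only [qhField, qhPart_blowUp]

theorem weighted_circle_pos {p q : ℕ} (hp : 0 < p) (hq : 0 < q) (φ : ℝ) :
    0 < p * Real.cos φ ^ 2 + q * Real.sin φ ^ 2 := by
  have hp' : (1 : ℝ) ≤ p := by exact_mod_cast hp
  have hq' : (1 : ℝ) ≤ q := by exact_mod_cast hq
  nlinarith [Real.sin_sq_add_cos_sq φ, sq_nonneg (Real.sin φ), sq_nonneg (Real.cos φ)]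

theorem hasDerivAt_blowUp_const (p q : ℕ) (φ : ℝ) {y : ℝ → ℝ} {y' t : ℝ} (hy : HasDerivAt y y' t) :
    HasDerivAt (fun τ => blowUp p q φ (y τ))
      (p * y t ^ (p - 1) * y' * Real.cos φ, q * y t ^ (q - 1) * y' * Real.sin φ) t :=
  ((hy.pow p).mul_const _).prodMk ((hy.pow q).mul_const _)

/-- A weighted ray along which the quasihomogeneous field `V` is radial is invariant: a solution
that starts on it stays on it for some time. -/
theorem eventually_mem_ray {p q r : ℕ} (hp : 0 < p) (hq : 0 < q) {V : ℝ × ℝ → ℝ × ℝ}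
    (hV : ContDiff ℝ 1 V) {φ a : ℝ}
    (ha : ∀ ρ, V (blowUp p q φ ρ) =
      (a * p * Real.cos φ * ρ ^ (p + r), a * q * Real.sin φ * ρ ^ (q + r)))
    {γ : ℝ → ℝ × ℝ} {t T ρ₁ : ℝ} (htT : t < T) (hρ₁ : 0 < ρ₁) (hγt : γ t = blowUp p q φ ρ₁)
    (hγ : ∀ τ ∈ Set.Ico t T, HasDerivWithinAt γ (V (γ τ)) (Set.Ici τ) τ)
    (hγc : ContinuousOn γ (Set.Ico t T)) :
    ∀ᶠ τ in 𝓝[>] t, ∃ ρ > 0, γ τ = blowUp p q φ ρ := by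
  -- On the ray the field reduces to `y' = a y^(r+1)`. A local solution of this scalar equation
  -- gives an orbit inside the ray, and uniqueness identifies it with `γ`.
  obtain ⟨y, hyt, η, hη, hy⟩ :=
    (show ContDiffAt ℝ 1 (fun x : ℝ => a * x ^ (r + 1)) ρ₁ by fun_prop)
      |>.exists_forall_mem_closedBall_exists_eq_forall_mem_Ioo_hasDerivAt₀ t
  have hζ : ∀ τ ∈ Set.Ioo (t - η) (t + η), HasDerivAt (fun τ => blowUp p q φ (y τ))
      (V (blowUp p q φ (y τ))) τ := by
    intro τ hτ
    refine (hasDerivAt_blowUp_const p q φ (hy τ hτ)).congr_deriv ?_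
    obtain ⟨p, rfl⟩ := Nat.exists_eq_succ_of_ne_zero hp.ne'
    obtain ⟨q, rfl⟩ := Nat.exists_eq_succ_of_ne_zero hq.ne'
    rw [ha]
    ext
    · simp only [Nat.succ_eq_add_one, Nat.add_sub_cancel]
      push_cast
      ring
    · simp only [Nat.succ_eq_add_one, Nat.add_sub_cancel]
      push_cast
      ring
  have ht : t ∈ Set.Ioo (t - η) (t + η) := ⟨by linarith, by linarith⟩
  obtain ⟨K, U, hU, hL⟩ := hV.contDiffAt.exists_lipschitzOnWith (x := γ t)
  have e1 : ∀ᶠ τ in 𝓝[≥] t, γ τ ∈ U := by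
    have : ContinuousWithinAt γ (Set.Ici t) t := (hγ t ⟨le_rfl, htT⟩).continuousWithinAt
    exact this hU
  have e2 : ∀ᶠ τ in 𝓝[≥] t, blowUp p q φ (y τ) ∈ U := by
    have := (hζ t ht).continuousAt
    rw [ContinuousAt, hyt, ← hγt] at this
    exact nhdsWithin_le_nhds (this hU)
  have e3 : ∀ᶠ τ in 𝓝[≥] t, 0 < y τ := by
    have := (hy t ht).continuousAt
    rw [ContinuousAt, hyt] at this
    exact nhdsWithin_le_nhds (this (lt_mem_nhds hρ₁))
  obtain ⟨t', htt', hall⟩ := (mem_nhdsGE_iff_exists_Ico_subset' htT).1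
    ((e1.and (e2.and e3)))
  have htt'' : t < t' := htt'
  set b := min (min ((t + t') / 2) ((t + T) / 2)) (t + η / 2)
  have hbt : t < b := lt_min (lt_min (by linarith) (by linarith)) (by linarith)
  have hb1 : b < t' := ((min_le_left _ _).trans (min_le_left _ _)).trans_lt (by linarith)
  have hb2 : b < T := ((min_le_left _ _).trans (min_le_right _ _)).trans_lt (by linarith)
  have hb3 : b < t + η := (min_le_right _ _).trans_lt (by linarith)
  have hsub : ∀ τ ∈ Set.Icc t b, τ ∈ Set.Ioo (t - η) (t + η) := fun τ hτ =>
    ⟨by linarith [hτ.1], hτ.2.trans_lt hb3⟩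
  have heq : Set.EqOn γ (fun τ => blowUp p q φ (y τ)) (Set.Icc t b) :=
    ODE_solution_unique_of_mem_Icc_right (v := fun _ => V) (s := fun _ => U) (K := K)
      (fun _ _ => hL)
      (hγc.mono fun τ hτ => ⟨hτ.1, hτ.2.trans_lt hb2⟩)
      (fun τ hτ => hγ τ ⟨hτ.1, hτ.2.trans hb2⟩)
      (fun τ hτ => (hall ⟨hτ.1, hτ.2.trans hb1⟩).1)
      (fun τ hτ => (hζ τ (hsub τ hτ)).continuousAt.continuousWithinAt)
      (fun τ hτ => (hζ τ (hsub τ ⟨hτ.1, hτ.2.le⟩)).hasDerivWithinAt)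
      (fun τ hτ => (hall ⟨hτ.1, hτ.2.trans hb1⟩).2.1)
      (by simp only [hyt, hγt])
  filter_upwards [Ioo_mem_nhdsGT hbt] with τ hτ
  exact ⟨y τ, (hall ⟨hτ.1.le, hτ.2.trans hb1⟩).2.2, heq ⟨hτ.1.le, hτ.2.le⟩⟩

/-- The angular component of a monodromic quasihomogeneous field has no zeros. -/
theorem angular_ne_zero_of_isMonodromic {p q r : ℕ} (hp : 0 < p) (hq : 0 < q)
    {X : ℝ × ℝ → ℝ × ℝ} (hmon : IsMonodromic (qhField p q r X)) (φ : ℝ) :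
    p * (qhField p q r X (Real.cos φ, Real.sin φ)).2 * Real.cos φ -
      q * (qhField p q r X (Real.cos φ, Real.sin φ)).1 * Real.sin φ ≠ 0 := by
  intro hG
  set V := qhField p q r X with hVdef
  have hV : ContDiff ℝ 1 V := (contDiff_qhPart _ _ _ _).prodMk (contDiff_qhPart _ _ _ _)
  set c := Real.cos φ with hc
  set s := Real.sin φ with hs
  have hD := weighted_circle_pos hp hq φ
  rw [← hc, ← hs] at hD
  have hcs : s ^ 2 + c ^ 2 = 1 := Real.sin_sq_add_cos_sq φ
  set P := (V (c, s)).1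
  set Q := (V (c, s)).2
  -- A zero of the angular component means that `(P, Q)` is parallel to `(p c, q s)`, the tangent of
  -- the weighted ray at `ρ = 1`.
  obtain ⟨a, haP, haQ⟩ : ∃ a : ℝ, P = a * p * c ∧ Q = a * q * s := by
    refine ⟨(P * c + Q * s) / (p * c ^ 2 + q * s ^ 2), ?_, ?_⟩
    · rw [div_mul_eq_mul_div, div_mul_eq_mul_div, eq_div_iff hD.ne']
      linear_combination (-s) * hG
    · rw [div_mul_eq_mul_div, div_mul_eq_mul_div, eq_div_iff hD.ne']
      linear_combination c * hG
  have ha : ∀ ρ, V (blowUp p q φ ρ) = (a * p * c * ρ ^ (p + r), a * q * s * ρ ^ (q + r)) := by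
    intro ρ
    rw [hVdef, qhField_blowUp, ← hVdef, ← hc, ← hs, ← haP, ← haQ]
  set m := max |c| |s| with hm
  have hm0 : 0 < m := by
    by_contra h
    have h1 : |c| ≤ 0 := (le_max_left _ _).trans (not_lt.1 h)
    have h2 : |s| ≤ 0 := (le_max_right _ _).trans (not_lt.1 h)
    rw [abs_nonpos_iff] at h1 h2
    rw [h1, h2] at hcs
    norm_num at hcs
  have hm1 : m ≤ 1 := max_le (Real.abs_cos_le_one φ) (Real.abs_sin_le_one φ)
  have hfar : ∀ ρ, 1 / m ≤ ρ → 1 ≤ ‖blowUp p q φ ρ‖ := by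
    intro ρ hρ
    have hρ1 : 1 ≤ ρ := le_trans (by rw [le_div_iff₀ hm0]; linarith) hρ
    have hρm : 1 ≤ ρ * m := by rwa [div_le_iff₀ hm0] at hρ
    refine hρm.trans ?_
    rw [hm, mul_max_of_nonneg _ _ (by linarith), Prod.norm_def]
    have hpow : ∀ n : ℕ, 0 < n → ρ ≤ ρ ^ n := fun n hn => le_self_pow₀ hρ1 hn.ne'
    refine max_le_max ?_ ?_
    · simp only [blowUp, norm_mul, Real.norm_eq_abs, abs_pow, abs_of_pos (zero_lt_one.trans_le hρ1)]
      gcongr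
      exact hpow p hp
    · simp only [blowUp, norm_mul, Real.norm_eq_abs, abs_pow, abs_of_pos (zero_lt_one.trans_le hρ1)]
      gcongr
      exact hpow q hq
  obtain ⟨δ, hδ, hturn⟩ := hmon.2 1 one_pos
  set ρ₀ := min (δ / 2) 1 with hρ₀
  have hρ₀0 : 0 < ρ₀ := by positivity
  have hcs0 : c ≠ 0 ∨ s ≠ 0 := by
    by_contra! h
    rw [h.1, h.2] at hcs
    norm_num at hcs
  have hz₀ : blowUp p q φ ρ₀ ≠ (0, 0) := by
    intro h
    rw [blowUp, Prod.mk.injEq] at h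
    rcases hcs0 with h' | h'
    · exact (mul_ne_zero (by positivity) h') h.1
    · exact (mul_ne_zero (by positivity) h') h.2
  have hz₀δ : ‖blowUp p q φ ρ₀‖ < δ := by
    have h1 := abs_blowUp_le hp hq (φ := φ) (ρ := ρ₀)
      (by rw [abs_of_pos hρ₀0]; exact min_le_right _ _)
    rw [abs_of_pos hρ₀0] at h1
    have h2 : ρ₀ < δ := (min_le_left _ _).trans_lt (by linarith)
    exact max_lt (h1.1.trans_lt h2) (h1.2.trans_lt h2)
  obtain ⟨T, hT, ϱ, θ, γ, hγ0, hθ, hγ, hrot⟩ := hturn _ hz₀ hz₀δ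
  have hγc : ContinuousOn γ (Set.Icc 0 T) := fun t ht => (hγ t ht).2.2.2.continuousWithinAt
  have hγne : ∀ t ∈ Set.Icc 0 T, γ t ≠ (0, 0) := by
    intro t ht h
    obtain ⟨h1, h2, -⟩ := hγ t ht
    rw [h2, Prod.mk.injEq, mul_eq_zero, mul_eq_zero] at h
    have h3 := Real.sin_sq_add_cos_sq (θ t)
    rw [h.1.resolve_left h1.ne', h.2.resolve_left h1.ne'] at h3
    norm_num at h3
  have hpos : ∀ t ∈ Set.Icc 0 T, ∀ ρ, 0 ≤ ρ → γ t = blowUp p q φ ρ → 0 < ρ := by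
    intro t ht ρ hρ h
    refine hρ.lt_of_ne fun h0 => hγne t ht ?_
    rw [h, ← h0]
    simp [blowUp, hp.ne', hq.ne']
  -- The times spent on this compact piece of the ray form a closed set that is open to the right.
  -- The orbit cannot leave through `ρ = 1 / m`, because `hfar` puts such points outside the unit
  -- ball in which it stays.
  have hinv : Set.Icc 0 T ⊆ γ ⁻¹' (blowUp p q φ '' Set.Icc 0 (1 / m)) := by
    refine IsClosed.Icc_subset_of_forall_mem_nhdsWithin ?_ ?_ ?_
    · rw [Set.inter_comm]
      refine hγc.preimage_isClosed_of_isClosed isClosed_Icc (IsCompact.isClosed ?_)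
      refine isCompact_Icc.image ?_
      unfold blowUp
      fun_prop
    · refine ⟨ρ₀, ⟨hρ₀0.le, (min_le_right _ _).trans ?_⟩, hγ0.symm⟩
      rw [le_div_iff₀ hm0]
      linarith
    · rintro t ⟨⟨ρ₁, hρ₁, hγt⟩, ht⟩
      have ht' : t ∈ Set.Icc 0 T := ⟨ht.1, ht.2.le⟩
      have h1 := eventually_mem_ray (r := r) hp hq hV ha ht.2 (hpos t ht' ρ₁ hρ₁.1 hγt.symm)
        hγt.symm (fun τ hτ => ((hγ τ ⟨ht.1.trans hτ.1, hτ.2.le⟩).2.2.2.mono_of_mem_nhdsWithin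
          (mem_of_superset (Icc_mem_nhdsGE hτ.2)
            (Set.Icc_subset_Icc_left (ht.1.trans hτ.1)))))
        (hγc.mono fun τ hτ => ⟨ht.1.trans hτ.1, hτ.2.le⟩)
      filter_upwards [h1, Ioo_mem_nhdsGT ht.2] with τ hτ hτ2
      obtain ⟨ρ, hρ, hτρ⟩ := hτ
      refine ⟨ρ, ⟨hρ.le, ?_⟩, hτρ.symm⟩
      by_contra hlt
      have h2 := hfar ρ (not_le.1 hlt).le
      have h3 := (hγ τ ⟨ht.1.trans hτ2.1.le, hτ2.2.le⟩).2.2.1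
      rw [hτρ] at h3
      linarith
  -- At a half turn the position is opposite to the initial one, whereas two points of the same ray
  -- have a positive inner product.
  obtain ⟨t, ht, htπ⟩ : ∃ t ∈ Set.Icc 0 T, |θ t - θ 0| = Real.pi := by
    have h1 : ContinuousOn (fun t => |θ t - θ 0|) (Set.Icc 0 T) :=
      (hθ.sub continuousOn_const).abs
    have h2 := intermediate_value_Icc hT.le h1
    simp only [sub_self, abs_zero, hrot] at h2
    exact h2 ⟨Real.pi_pos.le, by linarith [Real.pi_pos]⟩
  have hcos : Real.cos (θ t) * Real.cos (θ 0) + Real.sin (θ t) * Real.sin (θ 0) = -1 := by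
    rw [← Real.cos_sub, ← Real.cos_abs, htπ, Real.cos_pi]
  have h0 : (0 : ℝ) ∈ Set.Icc 0 T := ⟨le_rfl, hT.le⟩
  obtain ⟨ρ, hρ, hγρ⟩ := hinv ht
  have hρ0 := hpos t ht ρ hρ.1 hγρ.symm
  obtain ⟨hϱt, hγt, -⟩ := hγ t ht
  obtain ⟨hϱ0, hγ0', -⟩ := hγ 0 h0
  rw [hγt, blowUp, Prod.mk.injEq] at hγρ
  rw [hγ0', blowUp, Prod.mk.injEq] at hγ0
  have hpos1 : 0 < (ρ ^ p * c) * (ρ₀ ^ p * c) + (ρ ^ q * s) * (ρ₀ ^ q * s) := by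
    have e : (ρ ^ p * c) * (ρ₀ ^ p * c) + (ρ ^ q * s) * (ρ₀ ^ q * s) =
      (ρ ^ p * ρ₀ ^ p) * c ^ 2 + (ρ ^ q * ρ₀ ^ q) * s ^ 2 := by ring
    rw [e]
    rcases hcs0 with h | h
    · have : 0 < c ^ 2 := by positivity
      positivity
    · have : 0 < s ^ 2 := by positivity
      positivity
  rw [hγρ.1, hγρ.2, ← hc, ← hs] at *
  rw [← hγ0.1, ← hγ0.2] at hpos1
  have : ϱ t * Real.cos (θ t) * (ϱ 0 * Real.cos (θ 0)) +
      ϱ t * Real.sin (θ t) * (ϱ 0 * Real.sin (θ 0)) = -(ϱ t * ϱ 0) := by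
    linear_combination (ϱ t * ϱ 0) * hcos
  nlinarith [mul_pos hϱt hϱ0]

/-! ### Series of the polar equation and existence of the Poincaré expansion. -/

theorem GeomBounded.shift {a : ℕ → ℝ → ℝ} (h : GeomBounded a) (N : ℕ) :
    GeomBounded (fun k φ => a (k + N) φ) := by
  obtain ⟨C, hC, B, hB, hCB⟩ := h
  exact ⟨C * B ^ N, by positivity, B, hB, fun k φ => (hCB _ _).trans_eq (by rw [pow_add]; ring)⟩

theorem GeomBounded.mul_left {a : ℕ → ℝ → ℝ} (h : GeomBounded a) {c : ℝ → ℝ} {M : ℝ}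
    (hc : ∀ φ, |c φ| ≤ M) : GeomBounded (fun k φ => c φ * a k φ) := by
  obtain ⟨C, hC, B, hB, hCB⟩ := h
  have hM : 0 ≤ M := (abs_nonneg _).trans (hc 0)
  refine ⟨(M + 1) * C, by positivity, B, hB, fun k φ => ?_⟩
  rw [abs_mul, mul_assoc]
  exact mul_le_mul ((hc φ).trans (by linarith)) (hCB k φ) (abs_nonneg _) (by positivity)

theorem GeomBounded.add {a b : ℕ → ℝ → ℝ} (ha : GeomBounded a) (hb : GeomBounded b) :
    GeomBounded (fun k φ => a k φ + b k φ) := by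
  obtain ⟨C, hC, B, hB, hCB⟩ := ha
  obtain ⟨C', hC', B', hB', hCB'⟩ := hb
  refine ⟨C + C', by positivity, max B B', hB.trans (le_max_left _ _), fun k φ => ?_⟩
  refine (abs_add_le _ _).trans ?_
  rw [add_mul]
  refine add_le_add ((hCB k φ).trans ?_) ((hCB' k φ).trans ?_)
  · gcongr
    exact le_max_left _ _
  · gcongr
    exact le_max_right _ _

theorem GeomBounded.exists_abs_sub_le {a : ℕ → ℝ → ℝ} (h : GeomBounded a) :
    ∃ C > 0, ∃ ε > 0, ∀ ρ φ S : ℝ, |ρ| < ε → HasSum (fun k => a k φ * ρ ^ k) S →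
      |S - a 0 φ| ≤ C * |ρ| := by
  obtain ⟨C, hC, B, hB, hCB⟩ := h
  refine ⟨C * B * 2, by positivity, 1 / (2 * B), by positivity, fun ρ φ S hρ hS => ?_⟩
  have hρB : B * |ρ| ≤ 1 / 2 := by
    rw [lt_div_iff₀ (by positivity)] at hρ
    linarith
  have h1 : HasSum (fun k => a (k + 1) φ * ρ ^ (k + 1)) (S - a 0 φ) := by
    simpa using (hasSum_nat_add_iff' 1).2 hS
  have h2 : HasSum (fun k => C * B * |ρ| * (1 / 2 : ℝ) ^ k) (C * B * |ρ| * 2) :=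
    hasSum_geometric_two.mul_left _
  have h3 : ∀ k, ‖a (k + 1) φ * ρ ^ (k + 1)‖ ≤ C * B * |ρ| * (1 / 2 : ℝ) ^ k := by
    intro k
    rw [norm_mul, norm_pow, Real.norm_eq_abs, Real.norm_eq_abs]
    calc |a (k + 1) φ| * |ρ| ^ (k + 1) ≤ C * B ^ (k + 1) * |ρ| ^ (k + 1) := by
          gcongr
          exact hCB _ _
      _ = C * B * |ρ| * (B * |ρ|) ^ k := by rw [mul_pow]; ring
      _ ≤ _ := by gcongr
  have h4 := h2.summable.of_norm_bounded h3
  rw [← h1.tsum_eq, ← Real.norm_eq_abs]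
  refine (tsum_of_norm_bounded h2 h3).trans_eq (by ring)

theorem hasSum_shift_of_eq_zero {a : ℕ → ℝ} {N : ℕ} (ha : ∀ k < N, a k = 0) {ρ S : ℝ} (hρ : ρ ≠ 0)
    (h : HasSum (fun k => a k * ρ ^ k) S) :
    HasSum (fun k => a (k + N) * ρ ^ k) (S / ρ ^ N) := by
  have h1 := ((hasSum_nat_add_iff' N).2 h).div_const (ρ ^ N)
  rw [Finset.sum_eq_zero (fun k hk => by rw [ha k (Finset.mem_range.1 hk), zero_mul]),
    sub_zero] at h1
  refine h1.congr_fun fun k => ?_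
  rw [pow_add]
  field_simp

/-- The coefficient of `ρ ^ (k + 1)` in the radial component. -/
noncomputable def radialCoeff (p q r : ℕ) (X : ℝ × ℝ → ℝ × ℝ) (k : ℕ) (φ : ℝ) : ℝ :=
  Real.cos φ * qhPart p q (k + (p + r)) (fun w => (X w).1) (Real.cos φ, Real.sin φ) +
    Real.sin φ * qhPart p q (k + (q + r)) (fun w => (X w).2) (Real.cos φ, Real.sin φ)

/-- The coefficient of `ρ ^ k` in the angular component. -/
noncomputable def angularCoeff (p q r : ℕ) (X : ℝ × ℝ → ℝ × ℝ) (k : ℕ) (φ : ℝ) : ℝ :=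
  p * Real.cos φ * qhPart p q (k + (q + r)) (fun w => (X w).2) (Real.cos φ, Real.sin φ) +
    -(q * Real.sin φ) * qhPart p q (k + (p + r)) (fun w => (X w).1) (Real.cos φ, Real.sin φ)

theorem continuous_qhPart_circle (p q k : ℕ) (f : ℝ × ℝ → ℝ) :
    Continuous fun φ => qhPart p q k f (Real.cos φ, Real.sin φ) :=
  (continuous_qhPart p q k f).comp (Real.continuous_cos.prodMk Real.continuous_sin)

theorem continuous_radialCoeff (p q r : ℕ) (X : ℝ × ℝ → ℝ × ℝ) (k : ℕ) :
    Continuous (radialCoeff p q r X k) :=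
  (Real.continuous_cos.mul (continuous_qhPart_circle _ _ _ _)).add
    (Real.continuous_sin.mul (continuous_qhPart_circle _ _ _ _))

theorem continuous_angularCoeff (p q r : ℕ) (X : ℝ × ℝ → ℝ × ℝ) (k : ℕ) :
    Continuous (angularCoeff p q r X k) :=
  ((continuous_const.mul Real.continuous_cos).mul (continuous_qhPart_circle _ _ _ _)).add
    ((continuous_const.mul Real.continuous_sin).neg.mul (continuous_qhPart_circle _ _ _ _))

section

variable {p q r : ℕ} {X : ℝ × ℝ → ℝ × ℝ}

theorem geomBounded_radialCoeff (hp : 0 < p) (hq : 0 < q)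
    (hX₁ : AnalyticAt ℝ (fun w => (X w).1) (0, 0)) (hX₂ : AnalyticAt ℝ (fun w => (X w).2) (0, 0)) :
    GeomBounded (radialCoeff p q r X) :=
  (((geomBounded_qhPart hp hq hX₁).shift (p + r)).mul_left Real.abs_cos_le_one).add
    (((geomBounded_qhPart hp hq hX₂).shift (q + r)).mul_left Real.abs_sin_le_one)

theorem geomBounded_angularCoeff (hp : 0 < p) (hq : 0 < q)
    (hX₁ : AnalyticAt ℝ (fun w => (X w).1) (0, 0)) (hX₂ : AnalyticAt ℝ (fun w => (X w).2) (0, 0)) :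
    GeomBounded (angularCoeff p q r X) := by
  refine (((geomBounded_qhPart hp hq hX₂).shift (q + r)).mul_left (M := p) fun φ => ?_).add
    (((geomBounded_qhPart hp hq hX₁).shift (p + r)).mul_left (M := q) fun φ => ?_)
  · rw [abs_mul, Nat.abs_cast]
    exact mul_le_of_le_one_right (by positivity) (Real.abs_cos_le_one φ)
  · rw [abs_neg, abs_mul, Nat.abs_cast]
    exact mul_le_of_le_one_right (by positivity) (Real.abs_sin_le_one φ)

/-- `StartsAtDegree` removes exactly the terms that division by `ρ^(p+r)` and `ρ^(q+r)` would make
singular. -/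
theorem exists_hasSum_polar (hp : 0 < p) (hq : 0 < q)
    (hX₁ : AnalyticAt ℝ (fun w => (X w).1) (0, 0)) (hX₂ : AnalyticAt ℝ (fun w => (X w).2) (0, 0))
    (hX : StartsAtDegree p q r X) :
    ∃ ε > 0, ∀ φ ρ : ℝ, 0 < ρ → ρ < ε →
      HasSum (fun k => radialCoeff p q r X k φ * ρ ^ k) (polarR p q r X φ ρ / ρ) ∧
      HasSum (fun k => angularCoeff p q r X k φ * ρ ^ k) (polarTheta p q r X φ ρ) := by
  obtain ⟨ε₁, hε₁, h₁⟩ := exists_hasSum_qhPart_blowUp hp hq hX₁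
  obtain ⟨ε₂, hε₂, h₂⟩ := exists_hasSum_qhPart_blowUp hp hq hX₂
  refine ⟨min ε₁ ε₂, lt_min hε₁ hε₂, fun φ ρ hρ hρε => ?_⟩
  have k₁ := hasSum_shift_of_eq_zero (fun k hk => hX.1 k hk _) hρ.ne'
    (h₁ φ ρ (by rw [abs_of_pos hρ]; exact hρε.trans_le (min_le_left _ _)))
  have k₂ := hasSum_shift_of_eq_zero (fun k hk => hX.2 k hk _) hρ.ne'
    (h₂ φ ρ (by rw [abs_of_pos hρ]; exact hρε.trans_le (min_le_right _ _)))
  constructor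
  · have := (k₁.mul_left (Real.cos φ)).add (k₂.mul_left (Real.sin φ))
    convert! this using 1
    · ext k
      rw [radialCoeff]
      ring
    · rw [polarR, pow_add, pow_add]
      field_simp
  · have := (k₂.mul_left (p * Real.cos φ)).add (k₁.mul_left (-(q * Real.sin φ)))
    convert! this using 1
    · ext k
      rw [angularCoeff]
      ring
    · rw [polarTheta, pow_add, pow_add]
      field_simp
      ring

theorem angularCoeff_zero_ne_zero (hp : 0 < p) (hq : 0 < q)
    (hmon : IsMonodromic (qhField p q r X)) (φ : ℝ) : angularCoeff p q r X 0 φ ≠ 0 := by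
  have h := angular_ne_zero_of_isMonodromic hp hq hmon φ
  intro h0
  apply h
  rw [← h0, angularCoeff, zero_add, zero_add]
  simp only [qhField]
  ring

theorem exists_hasPoincareExpansion (hp : 0 < p) (hq : 0 < q)
    (hX₁ : AnalyticAt ℝ (fun w => (X w).1) (0, 0)) (hX₂ : AnalyticAt ℝ (fun w => (X w).2) (0, 0))
    (hX : StartsAtDegree p q r X) (hmon : IsMonodromic (qhField p q r X)) :
    ∃ η : ℕ → ℝ, HasPoincareExpansion p q r X η := by
  obtain ⟨ε, hε, hpol⟩ := exists_hasSum_polar hp hq hX₁ hX₂ hX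
  obtain ⟨C, hC, B, hB, hCB⟩ := geomBounded_radialCoeff (r := r) hp hq hX₁ hX₂
  obtain ⟨C', hC', B', hB', hCB'⟩ := geomBounded_angularCoeff (r := r) hp hq hX₁ hX₂
  have hT : 0 ≤ 2 * Real.pi := by positivity
  obtain ⟨w, hwa, hw0, hw⟩ := exists_analyticAt_radial_solution hT
    (fun k => ⟨fun t => radialCoeff p q r X k t,
      (continuous_radialCoeff p q r X k).comp continuous_subtype_val⟩)
    (fun k => ⟨fun t => angularCoeff p q r X k t,
      (continuous_angularCoeff p q r X k).comp continuous_subtype_val⟩)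
    (zero_lt_one.trans_le hB)
    (fun k => (ContinuousMap.norm_le _ (by positivity)).2 fun t => hCB k t)
    (zero_lt_one.trans_le hB')
    (fun k => (ContinuousMap.norm_le _ (by positivity)).2 fun t => hCB' k t)
    (fun t => angularCoeff_zero_ne_zero hp hq hmon t) hε
  let t₁ : Set.Icc 0 (2 * Real.pi) := ⟨2 * Real.pi, hT, le_rfl⟩
  let ev : IccFun (2 * Real.pi) →L[ℝ] ℝ := ContinuousMap.evalCLM ℝ t₁
  -- The Poincaré map is the value at `2π` of the analytic family of solutions, so its power series
  -- at `0` supplies `η`.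
  obtain ⟨P, hP⟩ : AnalyticAt ℝ (fun ρ => w ρ t₁) 0 :=
    AnalyticAt.comp (g := ev) (ev.analyticAt _) hwa
  refine ⟨P.coeff, ?_⟩
  have hsum := nhdsWithin_le_nhds (s := Set.Ioi 0) (hasFPowerSeriesAt_iff.1 hP)
  obtain ⟨δ, hδ, hall⟩ := (mem_nhdsGT_iff_exists_Ioo_subset).1 (hw.and hsum)
  refine ⟨δ, hδ, fun ρ₀ hρ₀ => ⟨w ρ₀ t₁, ?_, ?_⟩⟩
  · obtain ⟨⟨h0, hsol⟩, -⟩ := hall hρ₀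
    refine ⟨Set.IccExtend hT (w ρ₀), h0, Set.IccExtend_of_mem hT _ t₁.2, fun φ hφ => ?_⟩
    obtain ⟨hpos, hlt, N, D, hN, hD, hD0, hder⟩ := hsol ⟨φ, hφ⟩
    rw [Set.IccExtend_of_mem hT _ hφ]
    obtain ⟨hR, hΘ⟩ := hpol φ _ hpos hlt
    have e1 := hN.unique hR
    have e2 := hD.unique hΘ
    rw [← e2]
    refine ⟨hpos, hD0, hder.congr_deriv ?_⟩
    rw [e1]
    field_simp
  · obtain ⟨-, h1⟩ := hall hρ₀
    have h2 : P.coeff 0 = 0 := by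
      have := hP.coeff_zero (fun _ => 1)
      rw [hw0] at this
      exact this
    have h3 := (hasSum_nat_add_iff' 1).2 h1
    simp only [Finset.sum_range_one, zero_add, smul_eq_mul, h2, mul_zero, sub_zero] at h3
    exact h3.congr_fun fun k => mul_comm _ _

end

/-! ### Comparison estimates along polar solutions. -/

theorem eq_mul_exp_integral {a b : ℝ} (hab : a ≤ b) {w k : ℝ → ℝ} (hk : ContinuousOn k (Set.Icc a b))
    (hw : ∀ x ∈ Set.Icc a b, HasDerivWithinAt w (k x * w x) (Set.Icc a b) x) :
    ∀ x ∈ Set.Icc a b, w x = w a * Real.exp (∫ s in a..x, k s) := by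
  -- The constant extension is continuous on the whole line, so its primitive is differentiable at
  -- the endpoints too and serves as integrating factor.
  set k' : ℝ → ℝ := Set.IccExtend hab (Set.domRestrict (Set.Icc a b) k)
  have hk' : Continuous k' := (continuousOn_iff_continuous_domRestrict.1 hk).Icc_extend'
  have hkk : ∀ x ∈ Set.Icc a b, k' x = k x := fun x hx => by
    simp only [k', Set.IccExtend_of_mem hab _ hx, Set.domRestrict_apply]
  have hI : ∀ x, HasDerivAt (fun x => ∫ s in a..x, k' s) (k' x) x := fun x =>
    (hk'.integral_hasStrictDerivAt a x).hasDerivAt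
  have hconst := constant_of_has_deriv_right_zero
    (f := fun x => w x * Real.exp (-∫ s in a..x, k' s)) (a := a) (b := b)
    (fun x hx => (hw x hx).continuousWithinAt.mul (hI x).neg.exp.continuousAt.continuousWithinAt)
    (fun x hx => by
      have h1 := ((hw x ⟨hx.1, hx.2.le⟩).mono_of_mem_nhdsWithin
        (mem_of_superset (Icc_mem_nhdsGE hx.2) (Set.Icc_subset_Icc_left hx.1))).mul
        (hI x).neg.exp.hasDerivWithinAt (s := Set.Ici x)
      refine h1.congr_deriv ?_
      rw [hkk x ⟨hx.1, hx.2.le⟩]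
      ring)
  intro x hx
  have h2 := hconst x hx
  have h3 : ∫ s in a..x, k s = ∫ s in a..x, k' s := by
    refine intervalIntegral.integral_congr fun s hs => (hkk s ?_).symm
    rw [Set.uIcc_of_le hx.1] at hs
    exact ⟨hs.1, hs.2.trans hx.2⟩
  simp only [intervalIntegral.integral_same, neg_zero, Real.exp_zero, mul_one] at h2
  rw [h3, ← h2, mul_assoc, ← Real.exp_add, neg_add_cancel, Real.exp_zero, mul_one]

/-- A positive function with `|u'| ≤ M u` as long as `u` is small is comparable to its initial
value, if this is small enough. -/
theorem mul_exp_le_and_le_mul_exp {T M ε : ℝ} (hT : 0 ≤ T) (hM : 0 ≤ M) {u u' : ℝ → ℝ}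
    (hu : ∀ x ∈ Set.Icc 0 T, HasDerivWithinAt u (u' x) (Set.Icc 0 T) x)
    (hpos : ∀ x ∈ Set.Icc 0 T, 0 < u x) (hsmall : u 0 * Real.exp ((M + 1) * T) < ε)
    (hbound : ∀ x ∈ Set.Icc 0 T, u x < ε → |u' x| ≤ M * u x) :
    ∀ x ∈ Set.Icc 0 T, u 0 * Real.exp (-((M + 1) * T)) ≤ u x ∧
      u x ≤ u 0 * Real.exp ((M + 1) * T) := by
  have h0 : 0 < u 0 := hpos 0 ⟨le_rfl, hT⟩
  have hcont : ContinuousOn u (Set.Icc 0 T) := fun x hx => (hu x hx).continuousWithinAt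
  have hder : ∀ x ∈ Set.Ico 0 T, HasDerivWithinAt u (u' x) (Set.Ici x) x := fun x hx =>
    (hu x ⟨hx.1, hx.2.le⟩).mono_of_mem_nhdsWithin
      (mem_of_superset (Icc_mem_nhdsGE hx.2) (Set.Icc_subset_Icc_left hx.1))
  have hB : ∀ c d x : ℝ, HasDerivAt (fun x => d * Real.exp (c * x)) (c * (d * Real.exp (c * x))) x := by
    intro c d x
    refine ((((hasDerivAt_id x).const_mul c).exp).const_mul d).congr_deriv ?_
    simp only [id]
    ring
  have hexp : ∀ x ∈ Set.Icc 0 T, u 0 * Real.exp ((M + 1) * x) ≤ u 0 * Real.exp ((M + 1) * T) := by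
    intro x hx
    gcongr
    exact hx.2
  -- The rate `M + 1` instead of `M` gives the strict inequality of derivatives at a contact point.
  -- At such a point `u x < ε` holds automatically, so smallness along the whole solution need not
  -- be known beforehand.
  have hup : ∀ x ∈ Set.Icc 0 T, u x ≤ u 0 * Real.exp ((M + 1) * x) :=
    image_le_of_deriv_right_lt_deriv_boundary hcont hder (by simp) (hB (M + 1) (u 0))
      fun x hx hx' => by
        have hxI : x ∈ Set.Icc 0 T := ⟨hx.1, hx.2.le⟩
        have h1 : u x < ε := hx' ▸ (hexp x hxI).trans_lt hsmall
        have h2 := (abs_le.1 (hbound x hxI h1)).2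
        rw [← hx']
        linarith [hpos x hxI]
  have hlow : ∀ x ∈ Set.Icc 0 T, (-u) x ≤ -u 0 * Real.exp (-(M + 1) * x) :=
    image_le_of_deriv_right_lt_deriv_boundary hcont.neg (fun x hx => (hder x hx).neg) (by simp)
      (hB (-(M + 1)) (-u 0)) fun x hx hx' => by
        have hxI : x ∈ Set.Icc 0 T := ⟨hx.1, hx.2.le⟩
        have h1 : u x < ε := ((hup x hxI).trans (hexp x hxI)).trans_lt hsmall
        have h2 := (abs_le.1 (hbound x hxI h1)).1
        rw [← hx', Pi.neg_apply]
        linarith [hpos x hxI]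
  intro x hx
  refine ⟨?_, (hup x hx).trans (hexp x hx)⟩
  have h1 := hlow x hx
  rw [Pi.neg_apply, neg_mul, neg_le_neg_iff, neg_mul] at h1
  refine le_trans ?_ h1
  gcongr
  exact hx.2

theorem abs_div_sub_div_le {A A₀ G G₀ a b g M ρ : ℝ} (hg : 0 < g) (hG₀ : g ≤ |G₀|) (hA₀ : |A₀| ≤ M)
    (hA : |A - A₀| ≤ a * ρ) (hG : |G - G₀| ≤ b * ρ) (hρ : b * ρ ≤ g / 2) :
    G ≠ 0 ∧ |A / G - A₀ / G₀| ≤ (2 * a / g + 2 * M * b / g ^ 2) * ρ := by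
  have h1 : g / 2 ≤ |G| := by
    have := abs_sub_abs_le_abs_sub G₀ G
    rw [abs_sub_comm] at this
    linarith
  have hG0 : G ≠ 0 := abs_pos.1 ((half_pos hg).trans_le h1)
  have hG₀0 : G₀ ≠ 0 := abs_pos.1 (hg.trans_le hG₀)
  have hM : 0 ≤ M := (abs_nonneg _).trans hA₀
  refine ⟨hG0, ?_⟩
  have e : A / G - A₀ / G₀ = (A - A₀) / G + A₀ * (G₀ - G) / (G * G₀) := by
    field_simp
    ring
  rw [e]
  refine (abs_add_le _ _).trans ?_
  rw [abs_div, abs_div, abs_mul, abs_mul, abs_sub_comm G₀ G]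
  calc |A - A₀| / |G| + |A₀| * |G - G₀| / (|G| * |G₀|)
      ≤ a * ρ / (g / 2) + M * (b * ρ) / (g / 2 * g) := by
        have := (abs_nonneg _).trans hA
        have := (abs_nonneg _).trans hG
        gcongr
    _ = _ := by field_simp

section

variable {p q r : ℕ} {X : ℝ × ℝ → ℝ × ℝ}

theorem exists_pos_le_abs_angularCoeff (hp : 0 < p) (hq : 0 < q)
    (hmon : IsMonodromic (qhField p q r X)) :
    ∃ g > 0, ∀ φ ∈ Set.Icc 0 (2 * Real.pi), g ≤ |angularCoeff p q r X 0 φ| := by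
  obtain ⟨φ₀, -, h⟩ := isCompact_Icc.exists_isMinOn (s := Set.Icc 0 (2 * Real.pi))
    ⟨0, le_rfl, by positivity⟩ (continuous_angularCoeff p q r X 0).abs.continuousOn
  exact ⟨_, abs_pos.2 (angularCoeff_zero_ne_zero hp hq hmon φ₀), fun φ hφ => h hφ⟩

/-- A solution of the Cauchy problem in the definition of the Poincaré map. -/
def IsPolarSolution (p q r : ℕ) (X : ℝ × ℝ → ℝ × ℝ) (u : ℝ → ℝ) : Prop :=
  ∀ φ ∈ Set.Icc 0 (2 * Real.pi),
    0 < u φ ∧ polarTheta p q r X φ (u φ) ≠ 0 ∧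
    HasDerivWithinAt u (polarR p q r X φ (u φ) / polarTheta p q r X φ (u φ))
      (Set.Icc 0 (2 * Real.pi)) φ

/-- Since `R / (ρ Θ)` is close to the bounded quotient of the leading coefficients for small `ρ`,
the logarithmic derivative of a small solution is bounded, and one `κ` serves all solutions that
start near `0`. -/
theorem exists_polarSolution_bounds (hp : 0 < p) (hq : 0 < q)
    (hX₁ : AnalyticAt ℝ (fun w => (X w).1) (0, 0)) (hX₂ : AnalyticAt ℝ (fun w => (X w).2) (0, 0))
    (hX : StartsAtDegree p q r X) (hmon : IsMonodromic (qhField p q r X)) :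
    ∃ κ ≥ 1, ∃ δ > 0, ∀ u, IsPolarSolution p q r X u → u 0 < δ →
      ∀ φ ∈ Set.Icc 0 (2 * Real.pi), u 0 / κ ≤ u φ ∧ u φ ≤ κ * u 0 := by
  obtain ⟨ε, hε, hpol⟩ := exists_hasSum_polar hp hq hX₁ hX₂ hX
  have hbR := geomBounded_radialCoeff (r := r) hp hq hX₁ hX₂
  obtain ⟨a, ha, εa, hεa, hR⟩ := hbR.exists_abs_sub_le
  obtain ⟨b, hb, εb, hεb, hΘ⟩ :=
    (geomBounded_angularCoeff (r := r) hp hq hX₁ hX₂).exists_abs_sub_le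
  obtain ⟨C, hC, B, hB, hCB⟩ := hbR
  obtain ⟨g, hg, hgle⟩ := exists_pos_le_abs_angularCoeff hp hq hmon
  -- `C / g` bounds the leading quotient; the bracket is the constant of `abs_div_sub_div_le` for
  -- the remainder, used with `u < 1`.
  set M := C / g + (2 * a / g + 2 * C * b / g ^ 2) with hMdef
  have hM : 0 ≤ M := by positivity
  set ε' := min (min ε (min εa εb)) (min (g / (2 * b)) 1) with hε'
  have hε'0 : 0 < ε' := by positivity
  have hκ : 1 ≤ Real.exp ((M + 1) * (2 * Real.pi)) := Real.one_le_exp (by positivity)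
  refine ⟨Real.exp ((M + 1) * (2 * Real.pi)), hκ, ε' / Real.exp ((M + 1) * (2 * Real.pi)),
    by positivity, fun u hu hu0 φ hφ => ?_⟩
  have := mul_exp_le_and_le_mul_exp (by positivity) hM (fun x hx => (hu x hx).2.2)
    (fun x hx => (hu x hx).1) ((lt_div_iff₀ (Real.exp_pos _)).1 hu0) ?_ φ hφ
  · rw [Real.exp_neg, ← div_eq_mul_inv] at this
    exact ⟨this.1, this.2.trans_eq (mul_comm _ _)⟩
  · intro x hx hux
    obtain ⟨hpos, -, -⟩ := hu x hx
    have l1 : u x < ε := hux.trans_le ((min_le_left _ _).trans (min_le_left _ _))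
    have l2 : |u x| < εa := (abs_of_pos hpos).trans_lt (hux.trans_le
      ((min_le_left _ _).trans ((min_le_right _ _).trans (min_le_left _ _))))
    have l3 : |u x| < εb := (abs_of_pos hpos).trans_lt (hux.trans_le
      ((min_le_left _ _).trans ((min_le_right _ _).trans (min_le_right _ _))))
    have l4 : u x < g / (2 * b) := hux.trans_le ((min_le_right _ _).trans (min_le_left _ _))
    have l5 : u x < 1 := hux.trans_le ((min_le_right _ _).trans (min_le_right _ _))
    obtain ⟨s1, s2⟩ := hpol x _ hpos l1
    have t1 := hR _ _ _ l2 s1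
    have t2 := hΘ _ _ _ l3 s2
    rw [abs_of_pos hpos] at t1 t2
    rw [lt_div_iff₀ (by positivity)] at l4
    have t3 : |radialCoeff p q r X 0 x| ≤ C := by simpa using hCB 0 x
    have t4 := (abs_div_sub_div_le hg (hgle x hx) t3 t1 t2 (by linarith)).2
    have t5 : |radialCoeff p q r X 0 x / angularCoeff p q r X 0 x| ≤ C / g := by
      rw [abs_div]
      gcongr
      exact hgle x hx
    have t6 : |polarR p q r X x (u x) / u x / polarTheta p q r X x (u x)| ≤ M := by
      have h1 := abs_sub_abs_le_abs_sub
        (polarR p q r X x (u x) / u x / polarTheta p q r X x (u x))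
        (radialCoeff p q r X 0 x / angularCoeff p q r X 0 x)
      have h2 : (2 * a / g + 2 * C * b / g ^ 2) * u x ≤ 2 * a / g + 2 * C * b / g ^ 2 :=
        mul_le_of_le_one_right (by positivity) l5.le
      linarith
    have e : polarR p q r X x (u x) / polarTheta p q r X x (u x) =
        polarR p q r X x (u x) / u x / polarTheta p q r X x (u x) * u x := by
      field_simp
    rw [e, abs_mul, abs_of_pos hpos]
    gcongr

/-- Using `φ` as time only rescales the field by a scalar. This lets the relation `X(F) = K F` be
used along polar solutions. -/
theorem IsPolarSolution.hasDerivWithinAt_blowUp (hp : 0 < p) (hq : 0 < q) {u : ℝ → ℝ}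
    (hu : IsPolarSolution p q r X u) {φ : ℝ} (hφ : φ ∈ Set.Icc 0 (2 * Real.pi)) :
    HasDerivWithinAt (fun φ => blowUp p q φ (u φ))
      (((p * Real.cos φ ^ 2 + q * Real.sin φ ^ 2) / (u φ ^ r * polarTheta p q r X φ (u φ))) •
        X (blowUp p q φ (u φ))) (Set.Icc 0 (2 * Real.pi)) φ := by
  obtain ⟨hpos, hΘ, hd⟩ := hu φ hφ
  refine (((hd.pow p).mul (Real.hasDerivAt_cos φ).hasDerivWithinAt).prodMk
    ((hd.pow q).mul (Real.hasDerivAt_sin φ).hasDerivWithinAt)).congr_deriv ?_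
  obtain ⟨p, rfl⟩ := Nat.exists_eq_succ_of_ne_zero hp.ne'
  obtain ⟨q, rfl⟩ := Nat.exists_eq_succ_of_ne_zero hq.ne'
  set Θ := polarTheta (p + 1) (q + 1) r X φ (u φ) with hΘd
  set R := polarR (p + 1) (q + 1) r X φ (u φ) with hRd
  have hΘe := hΘd
  have hRe := hRd
  rw [polarTheta] at hΘe
  rw [polarR] at hRe
  set Z := X (blowUp (p + 1) (q + 1) φ (u φ))
  simp only [Nat.succ_eq_add_one, Nat.add_sub_cancel]
  ext
  · have h : ((p + 1 : ℕ) : ℝ) * u φ ^ p * R * Real.cos φ - u φ ^ (p + 1) * Real.sin φ * Θ =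
        (((p + 1 : ℕ) : ℝ) * Real.cos φ ^ 2 + ((q + 1 : ℕ) : ℝ) * Real.sin φ ^ 2) / u φ ^ r *
          Z.1 := by
      rw [hΘe, hRe]
      field_simp
      ring
    simp only [Prod.smul_fst, smul_eq_mul, Pi.pow_apply]
    rw [← div_div, div_mul_eq_mul_div, ← h]
    field_simp
    ring
  · have h : ((q + 1 : ℕ) : ℝ) * u φ ^ q * R * Real.sin φ + u φ ^ (q + 1) * Real.cos φ * Θ =
        (((p + 1 : ℕ) : ℝ) * Real.cos φ ^ 2 + ((q + 1 : ℕ) : ℝ) * Real.sin φ ^ 2) / u φ ^ r *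
          Z.2 := by
      rw [hΘe, hRe]
      field_simp
      ring
    simp only [Prod.smul_snd, smul_eq_mul, Pi.pow_apply]
    rw [← div_div, div_mul_eq_mul_div, ← h]
    field_simp

/-! ### The cofactor along solutions and its integral over one turn. -/

/-- The logarithmic derivative of an invariant curve with cofactor `K` with respect to `φ`. -/
noncomputable def polarCofactor (p q r : ℕ) (X : ℝ × ℝ → ℝ × ℝ) (K : ℝ × ℝ → ℝ) (φ ρ : ℝ) : ℝ :=
  (p * Real.cos φ ^ 2 + q * Real.sin φ ^ 2) / (ρ ^ r * polarTheta p q r X φ ρ) *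
    K (blowUp p q φ ρ)

/-- The leading coefficient of `polarCofactor`. -/
noncomputable def leadingCofactor (p q r s : ℕ) (X : ℝ × ℝ → ℝ × ℝ) (K : ℝ × ℝ → ℝ) (φ : ℝ) : ℝ :=
  (p * Real.cos φ ^ 2 + q * Real.sin φ ^ 2) *
    (qhPart p q s K (Real.cos φ, Real.sin φ) / angularCoeff p q r X 0 φ)

theorem exists_abs_polarCofactor_sub_le (hp : 0 < p) (hq : 0 < q)
    (hX₁ : AnalyticAt ℝ (fun w => (X w).1) (0, 0)) (hX₂ : AnalyticAt ℝ (fun w => (X w).2) (0, 0))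
    (hX : StartsAtDegree p q r X) (hmon : IsMonodromic (qhField p q r X)) {K : ℝ × ℝ → ℝ}
    (hK : AnalyticAt ℝ K (0, 0)) {n : ℕ} (hKn : ∀ k < n + r, ∀ z, qhPart p q k K z = 0) :
    ∃ C > 0, ∃ ε > 0, ∀ φ ∈ Set.Icc 0 (2 * Real.pi), ∀ ρ, 0 < ρ → ρ < ε →
      |polarCofactor p q r X K φ ρ - ρ ^ n * leadingCofactor p q r (n + r) X K φ| ≤
        C * ρ ^ (n + 1) := by
  obtain ⟨ε, hε, hpol⟩ := exists_hasSum_polar hp hq hX₁ hX₂ hX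
  obtain ⟨εK, hεK, hKs⟩ := exists_hasSum_qhPart_blowUp hp hq hK
  have hbK := (geomBounded_qhPart hp hq hK).shift (n + r)
  obtain ⟨a, ha, εa, hεa, hA⟩ := hbK.exists_abs_sub_le
  obtain ⟨b, hb, εb, hεb, hΘ⟩ :=
    (geomBounded_angularCoeff (r := r) hp hq hX₁ hX₂).exists_abs_sub_le
  obtain ⟨C, hC, B, hB, hCB⟩ := hbK
  obtain ⟨g, hg, hgle⟩ := exists_pos_le_abs_angularCoeff hp hq hmon
  refine ⟨(p + q) * (2 * a / g + 2 * C * b / g ^ 2), by positivity,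
    min (min ε (min εa εb)) (min (g / (2 * b)) εK), by positivity, fun φ hφ ρ hρ hρε => ?_⟩
  have l1 : ρ < ε := hρε.trans_le ((min_le_left _ _).trans (min_le_left _ _))
  have l2 : |ρ| < εa := (abs_of_pos hρ).trans_lt (hρε.trans_le
    ((min_le_left _ _).trans ((min_le_right _ _).trans (min_le_left _ _))))
  have l3 : |ρ| < εb := (abs_of_pos hρ).trans_lt (hρε.trans_le
    ((min_le_left _ _).trans ((min_le_right _ _).trans (min_le_right _ _))))
  have l4 : ρ < g / (2 * b) := hρε.trans_le ((min_le_right _ _).trans (min_le_left _ _))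
  have l5 : |ρ| < εK := (abs_of_pos hρ).trans_lt
    (hρε.trans_le ((min_le_right _ _).trans (min_le_right _ _)))
  have s1 := hasSum_shift_of_eq_zero (fun k hk => hKn k hk _) hρ.ne' (hKs φ ρ l5)
  have t1 := hA _ _ _ l2 s1
  have t2 := hΘ _ _ _ l3 (hpol φ _ hρ l1).2
  rw [abs_of_pos hρ] at t1 t2
  rw [lt_div_iff₀ (by positivity)] at l4
  have t3 : |qhPart p q (0 + (n + r)) K (Real.cos φ, Real.sin φ)| ≤ C := by simpa using hCB 0 φ
  obtain ⟨hΘ0, t4⟩ := abs_div_sub_div_le hg (hgle φ hφ) t3 t1 t2 (by linarith)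
  rw [zero_add] at t4
  have hD := weighted_circle_pos hp hq φ
  have hD' : p * Real.cos φ ^ 2 + q * Real.sin φ ^ 2 ≤ (p + q : ℝ) := by
    have := Real.cos_sq_le_one φ
    have := Real.sin_sq_le_one φ
    gcongr <;> exact mul_le_of_le_one_right (by positivity) ‹_›
  have e : polarCofactor p q r X K φ ρ - ρ ^ n * leadingCofactor p q r (n + r) X K φ =
      ρ ^ n * ((p * Real.cos φ ^ 2 + q * Real.sin φ ^ 2) *
        (K (blowUp p q φ ρ) / ρ ^ (n + r) / polarTheta p q r X φ ρ -
          qhPart p q (n + r) K (Real.cos φ, Real.sin φ) / angularCoeff p q r X 0 φ)) := by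
    rw [polarCofactor, leadingCofactor, pow_add, mul_sub, mul_sub]
    congr 1
    field_simp
  rw [e, abs_mul, abs_mul, abs_of_pos hD, abs_of_pos (pow_pos hρ n)]
  calc ρ ^ n * ((p * Real.cos φ ^ 2 + q * Real.sin φ ^ 2) * _)
      ≤ ρ ^ n * ((p + q) * ((2 * a / g + 2 * C * b / g ^ 2) * ρ)) := by gcongr
    _ = _ := by ring

end

/-- A constant sign excludes cancellation, so `I = ∫ |f|` works. It does not depend on `v`, which
will be a power of a solution varying with the initial value. -/
theorem exists_pos_mul_le_abs_integral {T : ℝ} (hT : 0 < T) {f : ℝ → ℝ} (hf : Continuous f)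
    (hsign : (∀ x, 0 ≤ f x) ∨ ∀ x, f x ≤ 0) (hne : ∃ x ∈ Set.Icc 0 T, f x ≠ 0) :
    ∃ I > 0, ∀ v : ℝ → ℝ, ContinuousOn v (Set.Icc 0 T) → ∀ m, (∀ x ∈ Set.Icc 0 T, m ≤ v x) →
      m * I ≤ |∫ x in (0 : ℝ)..T, v x * f x| := by
  obtain ⟨x₀, hx₀, hfx₀⟩ := hne
  refine ⟨∫ x in (0 : ℝ)..T, |f x|, intervalIntegral.integral_pos hT hf.abs.continuousOn
    (fun _ _ => abs_nonneg _) ⟨x₀, hx₀, abs_pos.2 hfx₀⟩, fun v hv m hm => ?_⟩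
  have h1 : m * ∫ x in (0 : ℝ)..T, |f x| ≤ ∫ x in (0 : ℝ)..T, v x * |f x| := by
    rw [← intervalIntegral.integral_const_mul]
    refine intervalIntegral.integral_mono_on hT.le
      ((continuous_const.mul hf.abs).intervalIntegrable _ _) ?_ fun x hx => ?_
    · refine ContinuousOn.intervalIntegrable ?_
      rw [Set.uIcc_of_le hT.le]
      exact hv.mul hf.abs.continuousOn
    · exact mul_le_mul_of_nonneg_right (hm x hx) (abs_nonneg _)
  refine h1.trans ?_
  rcases hsign with h | h
  · simp_rw [abs_of_nonneg (h _)]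
    exact le_abs_self _
  · simp_rw [abs_of_nonpos (h _), mul_neg, intervalIntegral.integral_neg]
    exact neg_le_abs _

theorem abs_integral_sub_le {T C κ ρ : ℝ} {n : ℕ} (hT : 0 ≤ T) (hC : 0 ≤ C)
    {k f u : ℝ → ℝ} (hk : ContinuousOn k (Set.Icc 0 T)) (hf : Continuous f)
    (hu : ContinuousOn u (Set.Icc 0 T)) (hu0 : ∀ x ∈ Set.Icc 0 T, 0 ≤ u x)
    (huκ : ∀ x ∈ Set.Icc 0 T, u x ≤ κ * ρ)
    (h : ∀ x ∈ Set.Icc 0 T, |k x - u x ^ n * f x| ≤ C * u x ^ (n + 1)) :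
    |(∫ x in (0 : ℝ)..T, k x) - ∫ x in (0 : ℝ)..T, u x ^ n * f x| ≤
      C * κ ^ (n + 1) * T * ρ ^ (n + 1) := by
  rw [← Set.uIcc_of_le hT] at hk hu
  have hI : IntervalIntegrable (fun x => u x ^ n * f x) MeasureTheory.volume 0 T :=
    ((hu.pow n).mul hf.continuousOn).intervalIntegrable
  rw [← intervalIntegral.integral_sub hk.intervalIntegrable hI]
  have := intervalIntegral.norm_integral_le_of_norm_le_const (a := 0) (b := T)
    (f := fun x => k x - u x ^ n * f x) (C := C * (κ * ρ) ^ (n + 1)) (fun x hx => by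
      rw [Set.uIoc_of_le hT] at hx
      have hx' : x ∈ Set.Icc 0 T := ⟨hx.1.le, hx.2⟩
      refine (h x hx').trans ?_
      have := hu0 x hx'
      gcongr
      exact huκ x hx')
  rw [sub_zero, abs_of_nonneg hT, Real.norm_eq_abs] at this
  refine this.trans_eq ?_
  rw [mul_pow]
  ring

section

variable {p q r : ℕ} {X : ℝ × ℝ → ℝ × ℝ}

theorem forall_pos_or_forall_neg {f : ℝ → ℝ} (hf : Continuous f) (h : ∀ x, f x ≠ 0) :
    (∀ x, 0 < f x) ∨ ∀ x, f x < 0 := by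
  by_contra! hcon
  obtain ⟨⟨a, ha⟩, b, hb⟩ := hcon
  obtain ⟨x, hx⟩ := mem_range_of_exists_le_of_exists_ge hf ⟨a, ha⟩ ⟨b, hb⟩
  exact h x hx

theorem continuous_leadingCofactor (hp : 0 < p) (hq : 0 < q)
    (hmon : IsMonodromic (qhField p q r X)) (s : ℕ) (K : ℝ × ℝ → ℝ) :
    Continuous (leadingCofactor p q r s X K) :=
  ((continuous_const.mul (Real.continuous_cos.pow 2)).add
    (continuous_const.mul (Real.continuous_sin.pow 2))).mul
    ((continuous_qhPart_circle p q s K).div (continuous_angularCoeff p q r X 0)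
      (angularCoeff_zero_ne_zero hp hq hmon))

theorem leadingCofactor_eq_zero_iff (hp : 0 < p) (hq : 0 < q)
    (hmon : IsMonodromic (qhField p q r X)) {s : ℕ} {K : ℝ × ℝ → ℝ} {φ : ℝ} :
    leadingCofactor p q r s X K φ = 0 ↔ qhPart p q s K (Real.cos φ, Real.sin φ) = 0 := by
  rw [leadingCofactor, mul_eq_zero, div_eq_zero_iff]
  simp [(weighted_circle_pos hp hq φ).ne', angularCoeff_zero_ne_zero hp hq hmon φ]

theorem leadingCofactor_sign (hp : 0 < p) (hq : 0 < q)
    (hmon : IsMonodromic (qhField p q r X)) {s : ℕ} {K : ℝ × ℝ → ℝ}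
    (hsign : SignDefinedOnCircle (qhPart p q s K)) :
    (∀ φ, 0 ≤ leadingCofactor p q r s X K φ) ∨ ∀ φ, leadingCofactor p q r s X K φ ≤ 0 := by
  have hD := weighted_circle_pos hp hq
  rcases forall_pos_or_forall_neg (continuous_angularCoeff p q r X 0)
    (angularCoeff_zero_ne_zero hp hq hmon) with hG | hG <;> rcases hsign with h | h
  · exact .inl fun φ => mul_nonneg (hD φ).le (div_nonneg (h φ) (hG φ).le)
  · exact .inr fun φ =>
      mul_nonpos_of_nonneg_of_nonpos (hD φ).le (div_nonpos_of_nonpos_of_nonneg (h φ) (hG φ).le)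
  · exact .inr fun φ =>
      mul_nonpos_of_nonneg_of_nonpos (hD φ).le (div_nonpos_of_nonneg_of_nonpos (h φ) (hG φ).le)
  · exact .inl fun φ => mul_nonneg (hD φ).le (div_nonneg_of_nonpos (h φ) (hG φ).le)

theorem IsPolarSolution.continuousOn {u : ℝ → ℝ} (hu : IsPolarSolution p q r X u) :
    ContinuousOn u (Set.Icc 0 (2 * Real.pi)) := fun φ hφ => (hu φ hφ).2.2.continuousWithinAt

theorem exists_invariantCurve_along_solution (hp : 0 < p) (hq : 0 < q)
    (hX₁ : AnalyticAt ℝ (fun w => (X w).1) (0, 0)) (hX₂ : AnalyticAt ℝ (fun w => (X w).2) (0, 0))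
    {F K : ℝ × ℝ → ℝ} (hFK : IsInvariantCurve X F K) :
    ∃ ε > 0, ∀ u, IsPolarSolution p q r X u → (∀ φ ∈ Set.Icc 0 (2 * Real.pi), u φ < ε) →
      ContinuousOn (fun φ => polarCofactor p q r X K φ (u φ)) (Set.Icc 0 (2 * Real.pi)) ∧
      ∀ φ ∈ Set.Icc 0 (2 * Real.pi), F (blowUp p q φ (u φ)) = F (blowUp p q 0 (u 0)) *
        Real.exp (∫ s in (0 : ℝ)..φ, polarCofactor p q r X K s (u s)) := by
  have hev := hFK.analytic_curve.eventually_analyticAt.and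
    (hFK.analytic_cofactor.eventually_analyticAt.and (hX₁.eventually_analyticAt.and
      (hX₂.eventually_analyticAt.and hFK.invariant)))
  obtain ⟨ε, hε, hball⟩ := Metric.eventually_nhds_iff.1 hev
  refine ⟨min ε 1, by positivity, fun u hu huε => ?_⟩
  have hz : ∀ φ ∈ Set.Icc 0 (2 * Real.pi), dist (blowUp p q φ (u φ)) (0, 0) < ε := by
    intro φ hφ
    have hpos := (hu φ hφ).1
    have h1 := abs_blowUp_le hp hq (φ := φ) (ρ := u φ)
      (by rw [abs_of_pos hpos]; exact ((huε φ hφ).trans_le (min_le_right _ _)).le)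
    rw [abs_of_pos hpos] at h1
    have h2 := (huε φ hφ).trans_le (min_le_left ε 1)
    rw [show ((0, 0) : ℝ × ℝ) = 0 from rfl, dist_zero_right]
    exact max_lt (h1.1.trans_lt h2) (h1.2.trans_lt h2)
  have hd := fun φ hφ => hu.hasDerivWithinAt_blowUp hp hq (φ := φ) hφ
  have hzc : ContinuousOn (fun φ => blowUp p q φ (u φ)) (Set.Icc 0 (2 * Real.pi)) := fun φ hφ =>
    (hd φ hφ).continuousWithinAt
  have huc := hu.continuousOn
  have hKc : ContinuousOn (fun φ => K (blowUp p q φ (u φ))) (Set.Icc 0 (2 * Real.pi)) :=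
    fun φ hφ => (hball (hz φ hφ)).2.1.continuousAt.comp_continuousWithinAt
      (f := fun φ => blowUp p q φ (u φ)) (hzc φ hφ)
  have hX₁c : ContinuousOn (fun φ => (X (blowUp p q φ (u φ))).1) (Set.Icc 0 (2 * Real.pi)) :=
    fun φ hφ => (hball (hz φ hφ)).2.2.1.continuousAt.comp_continuousWithinAt
      (f := fun φ => blowUp p q φ (u φ)) (hzc φ hφ)
  have hX₂c : ContinuousOn (fun φ => (X (blowUp p q φ (u φ))).2) (Set.Icc 0 (2 * Real.pi)) :=
    fun φ hφ => (hball (hz φ hφ)).2.2.2.1.continuousAt.comp_continuousWithinAt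
      (f := fun φ => blowUp p q φ (u φ)) (hzc φ hφ)
  have hupow : ∀ (m : ℕ), ∀ φ ∈ Set.Icc 0 (2 * Real.pi), u φ ^ m ≠ 0 := fun m φ hφ =>
    pow_ne_zero _ (hu φ hφ).1.ne'
  have hΘc : ContinuousOn (fun φ => polarTheta p q r X φ (u φ)) (Set.Icc 0 (2 * Real.pi)) :=
    (continuousOn_const.div (huc.pow r) (hupow r)).mul
      (((continuousOn_const.mul (hX₂c.div (huc.pow q) (hupow q))).mul
        Real.continuous_cos.continuousOn).sub
      ((continuousOn_const.mul (hX₁c.div (huc.pow p) (hupow p))).mul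
        Real.continuous_sin.continuousOn))
  have hkc : ContinuousOn (fun φ => polarCofactor p q r X K φ (u φ))
      (Set.Icc 0 (2 * Real.pi)) := by
    refine ContinuousOn.mul (ContinuousOn.div ?_ ((huc.pow r).mul hΘc)
      fun φ hφ => mul_ne_zero (hupow r φ hφ) (hu φ hφ).2.1) hKc
    exact Continuous.continuousOn (by fun_prop)
  refine ⟨hkc, eq_mul_exp_integral (by positivity) hkc fun φ hφ => ?_⟩
  have h1 := (hball (hz φ hφ)).1.differentiableAt.hasFDerivAt.comp_hasDerivWithinAt φ (hd φ hφ)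
  refine h1.congr_deriv ?_
  rw [map_smul, (hball (hz φ hφ)).2.2.2.2, smul_eq_mul, polarCofactor]
  ring

/-- `L(2π)` equals `∫ u^n f` up to `O(u(0)^(n+1))`, where `f` is the leading cofactor. Comparability
of `u` with `u 0` gives the upper bounds, and the sign condition the lower one. All constants are
chosen before the solution. -/
theorem exists_integral_polarCofactor_bounds (hp : 0 < p) (hq : 0 < q)
    (hX₁ : AnalyticAt ℝ (fun w => (X w).1) (0, 0)) (hX₂ : AnalyticAt ℝ (fun w => (X w).2) (0, 0))
    (hX : StartsAtDegree p q r X) (hmon : IsMonodromic (qhField p q r X)) {F K : ℝ × ℝ → ℝ}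
    (hFK : IsInvariantCurve X F K) {n : ℕ} (hKn : ∀ k < n + r, ∀ z, qhPart p q k K z = 0)
    (hsign : SignDefinedOnCircle (qhPart p q (n + r) K)) :
    ∃ κ ≥ 1, ∃ δ > 0, ∃ C > 0, ∃ c > 0, ∀ u, IsPolarSolution p q r X u → u 0 < δ →
      (∀ φ ∈ Set.Icc 0 (2 * Real.pi), u 0 / κ ≤ u φ ∧ u φ ≤ κ * u 0) ∧ ∃ L : ℝ → ℝ,
        (∀ φ ∈ Set.Icc 0 (2 * Real.pi), F (blowUp p q φ (u φ)) =
          F (blowUp p q 0 (u 0)) * Real.exp (L φ)) ∧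
        |L (2 * Real.pi)| ≤ C * u 0 ^ n ∧
        ((∀ φ : ℝ, qhPart p q (n + r) K (Real.cos φ, Real.sin φ) = 0) →
          |L (2 * Real.pi)| ≤ C * u 0 ^ (n + 1)) ∧
        ((¬ ∀ φ : ℝ, qhPart p q (n + r) K (Real.cos φ, Real.sin φ) = 0) →
          c * u 0 ^ n ≤ |L (2 * Real.pi)|) := by
  have hT : 0 < 2 * Real.pi := by positivity
  obtain ⟨κ, hκ, δ, hδ, hbd⟩ := exists_polarSolution_bounds hp hq hX₁ hX₂ hX hmon
  obtain ⟨C, hC, ε, hε, hest⟩ :=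
    exists_abs_polarCofactor_sub_le hp hq hX₁ hX₂ hX hmon hFK.analytic_cofactor hKn
  obtain ⟨ε', hε', hcurve⟩ := exists_invariantCurve_along_solution (r := r) hp hq hX₁ hX₂ hFK
  set f := leadingCofactor p q r (n + r) X K with hf
  have hfc : Continuous f := continuous_leadingCofactor hp hq hmon _ _
  obtain ⟨M, hM⟩ := isCompact_Icc.exists_bound_of_continuousOn
    (s := Set.Icc 0 (2 * Real.pi)) hfc.continuousOn
  have hM0 : 0 ≤ M := (norm_nonneg _).trans (hM 0 ⟨le_rfl, hT.le⟩)
  obtain ⟨I, hI, hlow⟩ : ∃ I > 0,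
      (¬ ∀ φ : ℝ, qhPart p q (n + r) K (Real.cos φ, Real.sin φ) = 0) →
      ∀ v : ℝ → ℝ, ContinuousOn v (Set.Icc 0 (2 * Real.pi)) → ∀ m,
        (∀ x ∈ Set.Icc 0 (2 * Real.pi), m ≤ v x) →
        m * I ≤ |∫ x in (0 : ℝ)..(2 * Real.pi), v x * f x| := by
    by_cases hv : ∀ φ : ℝ, qhPart p q (n + r) K (Real.cos φ, Real.sin φ) = 0
    · exact ⟨1, one_pos, fun h => absurd hv h⟩
    · obtain ⟨φ, hφ⟩ := not_forall.1 hv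
      -- Periodicity moves a point where the leading part is nonzero into `[0, 2π)`, the range of
      -- integration.
      have hper : Function.Periodic
          (fun φ => qhPart p q (n + r) K (Real.cos φ, Real.sin φ)) (2 * Real.pi) := fun φ => by
        simp
      obtain ⟨φ', hφ', he⟩ := hper.exists_mem_Ico₀ hT φ
      obtain ⟨I, hI, h⟩ := exists_pos_mul_le_abs_integral hT hfc
        (leadingCofactor_sign hp hq hmon hsign)
        ⟨φ', Set.Ico_subset_Icc_self hφ', fun h0 => hφ (by
          rw [leadingCofactor_eq_zero_iff hp hq hmon] at h0
          exact he.trans h0)⟩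
      exact ⟨I, hI, fun _ => h⟩
  set E := C * κ ^ (n + 1) * (2 * Real.pi) with hE
  have hE0 : 0 < E := by positivity
  -- The main term is at least `(u 0 / κ)^n I = 2 c (u 0)^n`; half of it absorbs the error `E (u
  -- 0)^(n+1)` as soon as `u 0 < c / E`.
  set c := I / κ ^ n / 2 with hc
  have hc0 : 0 < c := by positivity
  refine ⟨κ, hκ, min (min δ 1) (min (min (ε / κ) (ε' / κ)) (c / E)), by positivity,
    κ ^ n * M * (2 * Real.pi) + E, by positivity, c, hc0, fun u hu hu0 => ?_⟩
  have hκ0 : 0 < κ := by linarith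
  have h0 : 0 < u 0 := (hu 0 ⟨le_rfl, hT.le⟩).1
  have l1 : u 0 < δ := hu0.trans_le ((min_le_left _ _).trans (min_le_left _ _))
  have l2 : u 0 < 1 := hu0.trans_le ((min_le_left _ _).trans (min_le_right _ _))
  have l3 : u 0 < ε / κ := hu0.trans_le
    ((min_le_right _ _).trans ((min_le_left _ _).trans (min_le_left _ _)))
  have l4 : u 0 < ε' / κ := hu0.trans_le
    ((min_le_right _ _).trans ((min_le_left _ _).trans (min_le_right _ _)))
  have l5 : u 0 < c / E := hu0.trans_le ((min_le_right _ _).trans (min_le_right _ _))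
  rw [lt_div_iff₀ (by positivity), mul_comm] at l3 l4 l5
  have hb := hbd u hu l1
  obtain ⟨hkc, hcur⟩ := hcurve u hu fun φ hφ => (hb φ hφ).2.trans_lt l4
  refine ⟨hb, fun φ => ∫ s in (0 : ℝ)..φ, polarCofactor p q r X K s (u s), hcur, ?_⟩
  dsimp only
  set L := ∫ s in (0 : ℝ)..(2 * Real.pi), polarCofactor p q r X K s (u s)
  have hmain : |L - ∫ x in (0 : ℝ)..(2 * Real.pi), u x ^ n * f x| ≤ E * u 0 ^ (n + 1) :=
    abs_integral_sub_le hT.le hC.le hkc hfc hu.continuousOn (fun φ hφ => (hu φ hφ).1.le)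
      (fun φ hφ => (hb φ hφ).2)
      (fun φ hφ => hest φ hφ (u φ) (hu φ hφ).1 ((hb φ hφ).2.trans_lt l3))
  have hE1 : E * u 0 ^ (n + 1) ≤ E * u 0 ^ n := by
    gcongr 1
    exact pow_le_pow_of_le_one h0.le l2.le (Nat.le_succ n)
  have hup : |∫ x in (0 : ℝ)..(2 * Real.pi), u x ^ n * f x| ≤
      κ ^ n * M * (2 * Real.pi) * u 0 ^ n := by
    have := intervalIntegral.norm_integral_le_of_norm_le_const (a := 0) (b := 2 * Real.pi)
      (f := fun x => u x ^ n * f x) (C := (κ * u 0) ^ n * M) (fun x hx => by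
        rw [Set.uIoc_of_le hT.le] at hx
        have hx' : x ∈ Set.Icc 0 (2 * Real.pi) := ⟨hx.1.le, hx.2⟩
        have hux := (hu x hx').1
        rw [norm_mul, norm_pow, Real.norm_of_nonneg hux.le]
        gcongr
        · exact (hb x hx').2
        · exact hM x hx')
    rw [sub_zero, abs_of_pos hT, Real.norm_eq_abs] at this
    refine this.trans_eq ?_
    rw [mul_pow]
    ring
  refine ⟨?_, fun hv => ?_, fun hv => ?_⟩
  · have h1 := abs_sub_abs_le_abs_sub L (∫ x in (0 : ℝ)..(2 * Real.pi), u x ^ n * f x)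
    rw [add_mul]
    linarith
  · have hf0 : ∀ x, f x = 0 := fun x => (leadingCofactor_eq_zero_iff hp hq hmon).2 (hv x)
    simp only [hf0, mul_zero, intervalIntegral.integral_zero, sub_zero] at hmain
    refine hmain.trans ?_
    gcongr
    exact le_add_of_nonneg_left (by positivity)
  · have h1 := hlow hv (fun x => u x ^ n) (hu.continuousOn.pow n) ((u 0 / κ) ^ n) fun x hx => by
      gcongr
      exact (hb x hx).1
    have h2 : (u 0 / κ) ^ n * I = 2 * (c * u 0 ^ n) := by
      rw [hc, div_pow]
      field_simp
    have h3 : E * u 0 ^ (n + 1) ≤ c * u 0 ^ n := by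
      rw [pow_succ, mul_left_comm, mul_comm c]
      gcongr
    have h4 := abs_sub_abs_le_abs_sub (∫ x in (0 : ℝ)..(2 * Real.pi), u x ^ n * f x) L
    rw [abs_sub_comm] at h4
    linarith

end

/-! ### From the multiplier of the curve on the section to the displacement. -/

/-- With `h = x^k g`, `g(0) ≠ 0`, one has `x h'/h = k + x g'/g → k`. As `h(0) = 0` forces `k ≥ 1`,
the quotient eventually lies between `1/2` and `k + 1`. -/
theorem exists_logDeriv_bounds {h : ℝ → ℝ} (hh : AnalyticAt ℝ h 0) (h0 : h 0 = 0)
    (hne : ¬ ∀ᶠ x in 𝓝 0, h x = 0) :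
    ∃ m > 0, ∃ δ > 0, ∀ x, 0 < x → x < δ → h x ≠ 0 ∧ ∃ s : ℝ, 1 / 2 ≤ s ∧ s ≤ m ∧
      HasDerivAt h (s / x * h x) x := by
  obtain ⟨k, g, hg, hg0, hhg⟩ := hh.exists_eventuallyEq_pow_smul_nonzero_iff.2 hne
  have hk : 1 ≤ k := by
    by_contra hk
    obtain rfl : k = 0 := by omega
    have := hhg.self_of_nhds
    rw [h0] at this
    rw [pow_zero, one_smul] at this
    exact hg0 this.symm
  have hk1 : (1 : ℝ) ≤ k := by exact_mod_cast hk
  have hlim : Tendsto (fun x => k + x * deriv g x / g x) (𝓝 0) (𝓝 k) := by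
    have h1 : ContinuousAt (fun x => (k : ℝ) + x * deriv g x / g x) 0 :=
      continuousAt_const.add ((continuousAt_id.mul hg.deriv.continuousAt).div hg.continuousAt hg0)
    simpa [ContinuousAt] using h1
  have hev : ∀ᶠ x in 𝓝 0, (AnalyticAt ℝ g x ∧ g x ≠ 0) ∧ (∀ᶠ y in 𝓝 x, h y = (y - 0) ^ k • g y) ∧
      k + x * deriv g x / g x ∈ Set.Ioo (1 / 2 : ℝ) (k + 1) :=
    (hg.eventually_analyticAt.and (hg.continuousAt.eventually_ne hg0)).and
      (hhg.eventually_nhds.and (hlim (Ioo_mem_nhds (by linarith) (by linarith))))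
  obtain ⟨δ, hδ, hball⟩ := Metric.eventually_nhds_iff.1 hev
  refine ⟨k + 1, by linarith, δ, hδ, fun x hx hxδ => ?_⟩
  obtain ⟨⟨hga, hgx⟩, hhx, hs⟩ := hball
    (show dist x 0 < δ by rwa [dist_zero_right, Real.norm_of_nonneg hx.le])
  have hhx' : h x = x ^ k * g x := by simpa using hhx.self_of_nhds
  refine ⟨by rw [hhx']; positivity, _, hs.1.le, hs.2.le, ?_⟩
  have hd : HasDerivAt (fun y => y ^ k * g y) _ x :=
    (hasDerivAt_pow k x).mul hga.differentiableAt.hasDerivAt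
  refine (hd.congr_of_eventuallyEq ?_).congr_deriv ?_
  · filter_upwards [hhx] with y hy
    simpa using hy
  · rw [hhx']
    obtain ⟨k, rfl⟩ := Nat.exists_eq_succ_of_ne_zero (Nat.one_le_iff_ne_zero.1 hk)
    simp only [Nat.succ_eq_add_one, Nat.add_sub_cancel]
    field_simp
    ring

theorem exists_mem_uIcc_hasDerivAt_eq {f f' : ℝ → ℝ} {a b : ℝ}
    (hf : ∀ x ∈ Set.uIcc a b, HasDerivAt f (f' x) x) :
    ∃ x ∈ Set.uIcc a b, f b - f a = f' x * (b - a) := by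
  rcases lt_trichotomy a b with hab | rfl | hab
  · rw [Set.uIcc_of_le hab.le] at hf ⊢
    obtain ⟨x, hx, h⟩ := exists_hasDerivAt_eq_slope f f' hab
      (fun x hx => (hf x hx).continuousAt.continuousWithinAt)
      (fun x hx => hf x (Set.Ioo_subset_Icc_self hx))
    refine ⟨x, Set.Ioo_subset_Icc_self hx, ?_⟩
    rw [h, div_mul_cancel₀ _ (by linarith)]
  · exact ⟨a, Set.left_mem_uIcc, by simp⟩
  · rw [Set.uIcc_of_ge hab.le] at hf ⊢
    obtain ⟨x, hx, h⟩ := exists_hasDerivAt_eq_slope f f' hab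
      (fun x hx => (hf x hx).continuousAt.continuousWithinAt)
      (fun x hx => hf x (Set.Ioo_subset_Icc_self hx))
    refine ⟨x, Set.Ioo_subset_Icc_self hx, ?_⟩
    rw [h, div_mul_eq_mul_div, eq_div_iff (by linarith)]
    ring

theorem exists_displacement_bounds {h : ℝ → ℝ} (hh : AnalyticAt ℝ h 0) (h0 : h 0 = 0)
    (hne : ¬ ∀ᶠ x in 𝓝 0, h x = 0) {κ : ℝ} (hκ : 1 ≤ κ) :
    ∃ A > 0, ∃ δ > 0, ∀ a b L : ℝ, 0 < a → a < δ → a / κ ≤ b → b ≤ κ * a →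
      h b = h a * Real.exp L → |L| ≤ A * (|b - a| / a) ∧ |b - a| ≤ A * (a * |L|) := by
  obtain ⟨m, hm, δ, hδ, hbd⟩ := exists_logDeriv_bounds hh h0 hne
  have hκ0 : 0 < κ := by linarith
  refine ⟨max (m * κ) (2 * κ), by positivity, δ / κ, by positivity,
    fun a b L ha haδ hab hba hL => ?_⟩
  rw [lt_div_iff₀ hκ0, mul_comm] at haδ
  have hmem : ∀ x ∈ Set.uIcc a b, a / κ ≤ x ∧ x ≤ κ * a := by
    intro x hx
    have h1 : a / κ ≤ a := div_le_self ha.le hκ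
    have h2 : a ≤ κ * a := le_mul_of_one_le_left ha.le hκ
    exact ⟨(le_min h1 hab).trans hx.1, hx.2.trans (max_le h2 hba)⟩
  have hpos : ∀ x ∈ Set.uIcc a b, 0 < x := fun x hx =>
    (div_pos ha hκ0).trans_le (hmem x hx).1
  have hlt : ∀ x ∈ Set.uIcc a b, x < δ := fun x hx => (hmem x hx).2.trans_lt haδ
  choose! hhne s hs1 hs2 hder using hbd
  -- The mean value theorem for `log |h|` gives `L = (s x / x) (b - a)` with `x` comparable to `a`.
  -- `Real.log` ignores the sign of `h`, so only `h ≠ 0` is needed.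
  obtain ⟨x, hx, hmv⟩ := exists_mem_uIcc_hasDerivAt_eq (f := fun x => Real.log (h x))
    (f' := fun x => s x / x) (a := a) (b := b) fun x hx => by
      have hhx := hhne x (hpos x hx) (hlt x hx)
      refine ((hder x (hpos x hx) (hlt x hx)).log hhx).congr_deriv ?_
      field_simp
  have hha := hhne a ha (hlt a Set.left_mem_uIcc)
  rw [hL, Real.log_mul hha (Real.exp_pos L).ne', Real.log_exp, add_sub_cancel_left] at hmv
  have hx0 := hpos x hx
  have hsx1 := hs1 x hx0 (hlt x hx)
  have hsx2 := hs2 x hx0 (hlt x hx)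
  have hs0 : 0 < s x := by linarith
  have habs : |L| = s x / x * |b - a| := by
    rw [hmv, abs_mul, abs_of_pos (div_pos hs0 hx0)]
  constructor
  · calc |L| = s x / x * |b - a| := habs
      _ ≤ m / (a / κ) * |b - a| := by
        gcongr
        exact (hmem x hx).1
      _ = m * κ * (|b - a| / a) := by field_simp
      _ ≤ _ := by
        gcongr
        exact le_max_left _ _
  · calc |b - a| = x / s x * |L| := by
          rw [habs]
          field_simp
      _ ≤ κ * a / (1 / 2) * |L| := by
        gcongr
        exact (hmem x hx).2
      _ = 2 * κ * (a * |L|) := by ring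
      _ ≤ _ := by
        gcongr
        exact le_max_right _ _

/-! ### Reading coefficients off the size of a power series. -/

section PowerSeries

variable {d : ℕ → ℝ} {D : ℝ → ℝ} {ε : ℝ}

theorem exists_abs_div_pow_sub_coeff_le (hε : 0 < ε)
    (h : ∀ ρ ∈ Set.Ioo 0 ε, HasSum (fun i => d i * ρ ^ (i + 1)) (D ρ)) {j : ℕ}
    (hj : ∀ i < j, d i = 0) :
    ∃ C > 0, ∀ᶠ ρ in 𝓝[>] 0, |D ρ / ρ ^ (j + 1) - d j| ≤ C * ρ := by
  have hdiv : ∀ ρ ∈ Set.Ioo 0 ε, HasSum (fun i => d i * ρ ^ i) (D ρ / ρ) := by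
    intro ρ hρ
    refine ((h ρ hρ).div_const ρ).congr_fun fun i => ?_
    have := hρ.1.ne'
    rw [pow_succ]
    field_simp
  have hbdd : GeomBounded (fun i _ => d (i + j)) := by
    refine GeomBounded.shift (a := fun i _ => d i) ?_ j
    -- The terms at the single point `ε / 2` are bounded, which gives growth of the coefficients of
    -- order at most `(2 / ε)^i`.
    have hs := (hdiv (ε / 2) ⟨by positivity, by linarith⟩).summable.tendsto_atTop_zero
    obtain ⟨C, hC⟩ := hs.abs.bddAbove_range
    refine ⟨max C 1, by positivity, max (2 / ε) 1, le_max_right _ _, fun i _ => ?_⟩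
    have h1 : |d i * (ε / 2) ^ i| ≤ C := hC ⟨i, rfl⟩
    rw [abs_mul, abs_of_pos (show 0 < (ε / 2) ^ i by positivity), ← le_div_iff₀ (by positivity)] at h1
    calc |d i| ≤ C / (ε / 2) ^ i := h1
      _ = C * (2 / ε) ^ i := by rw [div_eq_mul_inv, ← inv_pow, inv_div]
      _ ≤ _ := by
        gcongr
        · exact le_max_left _ _
        · exact le_max_left _ _
  obtain ⟨C, hC, δ, hδ, hest⟩ := hbdd.exists_abs_sub_le
  refine ⟨C, hC, ?_⟩
  filter_upwards [Ioo_mem_nhdsGT (lt_min hε hδ)] with ρ hρ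
  have h1 := hasSum_shift_of_eq_zero hj hρ.1.ne'
    (hdiv ρ ⟨hρ.1, hρ.2.trans_le (min_le_left _ _)⟩)
  have h2 := hest ρ 0 _ (by rw [abs_of_pos hρ.1]; exact hρ.2.trans_le (min_le_right _ _)) h1
  rw [abs_of_pos hρ.1, zero_add, div_div, ← pow_succ'] at h2
  exact h2

theorem not_eventually_le_mul {c C : ℝ} (hc : 0 < c) : ¬ ∀ᶠ ρ in 𝓝[>] (0 : ℝ), c ≤ C * ρ := by
  intro h
  have h1 : Tendsto (fun ρ : ℝ => C * ρ) (𝓝[>] 0) (𝓝 0) := by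
    have : Continuous fun ρ : ℝ => C * ρ := by fun_prop
    simpa using (this.tendsto 0).mono_left nhdsWithin_le_nhds
  exact absurd (ge_of_tendsto h1 h) (not_le.2 hc)

/-- The index is shifted: `d j` multiplies `ρ^(j+1)`, so a bound of order `ρ^(m+1)` leaves `d m`
free. If the lowest nonzero coefficient had index `j < m`, dividing by `ρ^(j+1)` would give `|d j| =
O(ρ)`. -/
theorem coeff_eq_zero_of_abs_le (hε : 0 < ε)
    (h : ∀ ρ ∈ Set.Ioo 0 ε, HasSum (fun i => d i * ρ ^ (i + 1)) (D ρ)) {C : ℝ} {m : ℕ}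
    (hD : ∀ᶠ ρ in 𝓝[>] 0, |D ρ| ≤ C * ρ ^ (m + 1)) : ∀ j < m, d j = 0 := by
  intro j
  induction j using Nat.strong_induction_on with
  | _ j ih =>
    intro hjm
    obtain ⟨C', hC', hest⟩ := exists_abs_div_pow_sub_coeff_le hε h fun i hi =>
      ih i hi (hi.trans hjm)
    by_contra hne
    refine not_eventually_le_mul (C := |C| + C') (abs_pos.2 hne) ?_
    filter_upwards [hD, hest, Ioo_mem_nhdsGT one_pos] with ρ h1 h2 h3
    have h4 : |D ρ / ρ ^ (j + 1)| ≤ |C| * ρ := by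
      rw [abs_div, abs_of_pos (pow_pos h3.1 _), div_le_iff₀ (pow_pos h3.1 _)]
      refine h1.trans ?_
      calc C * ρ ^ (m + 1) ≤ |C| * ρ ^ (j + 2) := by
            refine mul_le_mul (le_abs_self C) ?_ (pow_pos h3.1 _).le (abs_nonneg _)
            exact pow_le_pow_of_le_one h3.1.le h3.2.le (by omega)
        _ = |C| * ρ * ρ ^ (j + 1) := by ring
    have h5 := abs_sub_abs_le_abs_sub (d j) (D ρ / ρ ^ (j + 1))
    rw [abs_sub_comm] at h5
    linarith

theorem coeff_ne_zero_of_le_abs (hε : 0 < ε)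
    (h : ∀ ρ ∈ Set.Ioo 0 ε, HasSum (fun i => d i * ρ ^ (i + 1)) (D ρ)) {c C : ℝ} (hc : 0 < c)
    {m : ℕ} (hD : ∀ᶠ ρ in 𝓝[>] 0, |D ρ| ≤ C * ρ ^ (m + 1))
    (hD' : ∀ᶠ ρ in 𝓝[>] 0, c * ρ ^ (m + 1) ≤ |D ρ|) : d m ≠ 0 := by
  intro hm
  obtain ⟨C', hC', hest⟩ := exists_abs_div_pow_sub_coeff_le hε h (coeff_eq_zero_of_abs_le hε h hD)
  refine not_eventually_le_mul (C := C') hc ?_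
  filter_upwards [hest, hD', self_mem_nhdsWithin] with ρ h1 h2 h3
  have h4 : 0 < ρ ^ (m + 1) := pow_pos h3 _
  rw [hm, sub_zero, abs_div, abs_of_pos h4] at h1
  exact ((le_div_iff₀ h4).2 h2).trans h1

end PowerSeries

/-! ### The weighted rays fill a neighbourhood, and the curve is nonzero on the section. -/

theorem exists_cos_sin_eq {x y : ℝ} (h : x ^ 2 + y ^ 2 = 1) :
    ∃ φ ∈ Set.Icc 0 (2 * Real.pi), Real.cos φ = x ∧ Real.sin φ = y := by
  have hn : ‖(⟨x, y⟩ : ℂ)‖ = 1 := by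
    rw [Complex.norm_def, Complex.normSq_mk, ← sq, ← sq, h, Real.sqrt_one]
  have h0 : (⟨x, y⟩ : ℂ) ≠ 0 := norm_ne_zero_iff.1 (by rw [hn]; norm_num)
  have hc := Complex.cos_arg h0
  have hs := Complex.sin_arg ⟨x, y⟩
  rw [hn, div_one] at hc hs
  have h1 := Complex.neg_pi_lt_arg ⟨x, y⟩
  have h2 := Complex.arg_le_pi ⟨x, y⟩
  rcases le_or_gt 0 (Complex.arg ⟨x, y⟩) with h3 | h3
  · exact ⟨_, ⟨h3, by linarith⟩, hc, hs⟩
  · exact ⟨Complex.arg ⟨x, y⟩ + 2 * Real.pi, ⟨by linarith, by linarith⟩,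
      by rw [Real.cos_add_two_pi, hc], by rw [Real.sin_add_two_pi, hs]⟩

/-- The radius solves `(x/ρ^p)^2 + (y/ρ^q)^2 = 1`. With denominators cleared, the intermediate value
theorem finds it between `b`, where the left side is at least the right one, and `e`, where it is
smaller because `z` is near the origin. -/
theorem eventually_mem_range_blowUp {p q : ℕ} (hp : 0 < p) (hq : 0 < q) {ε : ℝ} (hε : 0 < ε) :
    ∀ᶠ z in 𝓝 ((0, 0) : ℝ × ℝ), ∃ φ ∈ Set.Icc 0 (2 * Real.pi), ∃ ρ, |ρ| < ε ∧
      blowUp p q φ ρ = z := by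
  set e := ε / 2 with he
  have he0 : 0 < e := by positivity
  have hcont : Continuous fun z : ℝ × ℝ => z.1 ^ 2 * e ^ (2 * q) + z.2 ^ 2 * e ^ (2 * p) := by
    fun_prop
  have hsmall : ∀ᶠ z in 𝓝 ((0, 0) : ℝ × ℝ),
      z.1 ^ 2 * e ^ (2 * q) + z.2 ^ 2 * e ^ (2 * p) < e ^ (2 * p + 2 * q) :=
    hcont.continuousAt.eventually (gt_mem_nhds (by simp; positivity))
  filter_upwards [hsmall] with z hz
  by_cases hz0 : z = (0, 0)
  · refine ⟨0, ⟨le_rfl, by positivity⟩, 0, by simpa using hε, ?_⟩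
    rw [hz0, blowUp]
    simp [hp.ne']
  obtain ⟨x, y⟩ := z
  dsimp only at hz
  obtain ⟨b, hb, hbe, hbz⟩ : ∃ b, 0 < b ∧ b ≤ e ∧
      b ^ (2 * p + 2 * q) ≤ x ^ 2 * b ^ (2 * q) + y ^ 2 * b ^ (2 * p) := by
    have key : ∀ t : ℝ, t ≠ 0 → ∀ n : ℕ, 0 < n → min (min |t| 1) e ^ (2 * n) ≤ t ^ 2 := by
      intro t ht n hn
      have h1 : 0 < min (min |t| 1) e := lt_min (lt_min (abs_pos.2 ht) one_pos) he0
      calc min (min |t| 1) e ^ (2 * n) ≤ min (min |t| 1) e ^ 2 :=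
            pow_le_pow_of_le_one h1.le ((min_le_left _ _).trans (min_le_right _ _)) (by omega)
        _ ≤ |t| ^ 2 := by
            gcongr
            exact (min_le_left _ _).trans (min_le_left _ _)
        _ = t ^ 2 := sq_abs t
    by_cases hx : x = 0
    · have hy : y ≠ 0 := fun hy => hz0 (by rw [hx, hy])
      have h1 : 0 < min (min |y| 1) e := lt_min (lt_min (abs_pos.2 hy) one_pos) he0
      refine ⟨_, h1, min_le_right _ _, ?_⟩
      rw [pow_add, mul_comm]
      have h2 : 0 ≤ x ^ 2 * min (min |y| 1) e ^ (2 * q) := by positivity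
      have h3 := mul_le_mul_of_nonneg_right (key y hy q hq) (pow_pos h1 (2 * p)).le
      linarith
    · have h1 : 0 < min (min |x| 1) e := lt_min (lt_min (abs_pos.2 hx) one_pos) he0
      refine ⟨_, h1, min_le_right _ _, ?_⟩
      rw [pow_add]
      have h2 : 0 ≤ y ^ 2 * min (min |x| 1) e ^ (2 * p) := by positivity
      have h3 := mul_le_mul_of_nonneg_right (key x hx p hp) (pow_pos h1 (2 * q)).le
      linarith
  have hg : ContinuousOn (fun ρ : ℝ => ρ ^ (2 * p + 2 * q) -
      (x ^ 2 * ρ ^ (2 * q) + y ^ 2 * ρ ^ (2 * p))) (Set.Icc b e) :=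
    Continuous.continuousOn (by fun_prop)
  obtain ⟨ρ, hρ, hρ0⟩ := intermediate_value_Icc hbe hg
    (show (0 : ℝ) ∈ _ from ⟨by linarith, by linarith⟩)
  have hρpos : 0 < ρ := hb.trans_le hρ.1
  obtain ⟨φ, hφ, hc, hs⟩ := exists_cos_sin_eq (x := x / ρ ^ p) (y := y / ρ ^ q) (by
    have h1 : x ^ 2 * ρ ^ (2 * q) + y ^ 2 * ρ ^ (2 * p) = ρ ^ (2 * p + 2 * q) := by
      dsimp only at hρ0
      linarith
    rw [div_pow, div_pow, ← pow_mul, ← pow_mul, div_add_div _ _ (by positivity) (by positivity),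
      div_eq_one_iff_eq (by positivity), mul_comm p, mul_comm q, ← pow_add, ← h1]
    ring)
  refine ⟨φ, hφ, ρ, ?_, ?_⟩
  · rw [abs_of_pos hρpos]
    linarith [hρ.2]
  · rw [blowUp, hc, hs, mul_div_cancel₀ _ (by positivity), mul_div_cancel₀ _ (by positivity)]

section

variable {p q r : ℕ} {X : ℝ × ℝ → ℝ × ℝ}

theorem analyticAt_blowUp (p q : ℕ) (φ ρ : ℝ) : AnalyticAt ℝ (fun ρ => blowUp p q φ ρ) ρ := by
  unfold blowUp
  fun_prop

/-- An invariant curve does not vanish identically on the half-axis on which the Poincaré map is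
defined. -/
theorem not_eventually_eq_zero_on_section (hp : 0 < p) (hq : 0 < q) {F K : ℝ × ℝ → ℝ}
    (hFK : IsInvariantCurve X F K) {κ δ : ℝ} (hκ : 1 ≤ κ) (hδ : 0 < δ)
    (hsol : ∀ ρ₀ ∈ Set.Ioo 0 δ, ∃ u, IsPolarSolution p q r X u ∧ u 0 = ρ₀ ∧
      (∀ φ ∈ Set.Icc 0 (2 * Real.pi), u 0 / κ ≤ u φ ∧ u φ ≤ κ * u 0) ∧ ∃ L : ℝ → ℝ,
        ∀ φ ∈ Set.Icc 0 (2 * Real.pi), F (blowUp p q φ (u φ)) =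
          F (blowUp p q 0 (u 0)) * Real.exp (L φ)) :
    ¬ ∀ᶠ x in 𝓝 0, F (blowUp p q 0 x) = 0 := by
  intro hzero
  obtain ⟨δ', hδ', hzero⟩ := Metric.eventually_nhds_iff.1 hzero
  obtain ⟨ε, hε, hF⟩ := Metric.eventually_nhds_iff.1 hFK.analytic_curve.eventually_analyticAt
  have hκ0 : 0 < κ := by linarith
  apply hFK.nonzero
  filter_upwards [eventually_mem_range_blowUp hp hq (show 0 < min ε 1 by positivity)]
  rintro z ⟨φ, hφ, ρ, hρ, rfl⟩
  have han : AnalyticOnNhd ℝ (fun x => F (blowUp p q φ x)) (Metric.ball 0 (min ε 1)) := by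
    intro x hx
    have hx' : |x| < min ε 1 := by simpa using hx
    refine AnalyticAt.fun_comp (hF ?_) (analyticAt_blowUp p q φ x)
    have h1 := abs_blowUp_le hp hq (φ := φ) (hx'.trans_le (min_le_right _ _)).le
    have h2 := hx'.trans_le (min_le_left _ _)
    rw [show ((0, 0) : ℝ × ℝ) = 0 from rfl, dist_zero_right]
    exact max_lt (h1.1.trans_lt h2) (h1.2.trans_lt h2)
  -- If `F` vanishes on the section, it vanishes along each solution starting there. These solutions
  -- cross the ray `φ` at radii at most `κ ρ₀`, arbitrarily close to `0`, and the identity theorem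
  -- on the ray applies.
  have hfreq : ∃ᶠ x in 𝓝[≠] 0, F (blowUp p q φ x) = 0 := by
    rw [Filter.frequently_iff]
    intro U hU
    obtain ⟨η, hη, hηU⟩ := Metric.mem_nhdsWithin_iff.1 hU
    set ρ₀ := min (min (δ / 2) (δ' / 2)) (η / (2 * κ)) with hρ₀
    have hρ₀0 : 0 < ρ₀ := by positivity
    have hρ₀δ : ρ₀ < δ := ((min_le_left _ _).trans (min_le_left _ _)).trans_lt (by linarith)
    have hρ₀δ' : ρ₀ < δ' := ((min_le_left _ _).trans (min_le_right _ _)).trans_lt (by linarith)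
    have hρ₀η : κ * ρ₀ < η := by
      have : ρ₀ ≤ η / (2 * κ) := min_le_right _ _
      rw [le_div_iff₀ (by positivity)] at this
      nlinarith
    obtain ⟨u, hu, hu0, hb, L, hL⟩ := hsol ρ₀ ⟨hρ₀0, hρ₀δ⟩
    have hpos := (hu φ hφ).1
    refine ⟨u φ, hηU ⟨?_, hpos.ne'⟩, ?_⟩
    · rw [Metric.mem_ball, dist_zero_right, Real.norm_of_nonneg hpos.le]
      exact ((hb φ hφ).2.trans_eq (by rw [hu0])).trans_lt hρ₀η
    · rw [hL φ hφ, hu0, hzero (by rwa [dist_zero_right, Real.norm_of_nonneg hρ₀0.le]), zero_mul]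
  exact han.eqOn_zero_of_preconnected_of_frequently_eq_zero (convex_ball _ _).isPreconnected
    (Metric.mem_ball_self (by positivity)) hfreq (by simpa using hρ)

/-- The first coefficient of the displacement map `Π(ρ) - ρ` that can be nonzero vanishes if and
only if the leading part of the cofactor vanishes. -/
theorem displacement_coeff_eq_zero_iff (hp : 0 < p) (hq : 0 < q)
    (hX₁ : AnalyticAt ℝ (fun w => (X w).1) (0, 0)) (hX₂ : AnalyticAt ℝ (fun w => (X w).2) (0, 0))
    (hX : StartsAtDegree p q r X) (hmon : IsMonodromic (qhField p q r X)) {F K : ℝ × ℝ → ℝ}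
    (hFK : IsInvariantCurve X F K) {n : ℕ} (hKn : ∀ k < n + r, ∀ z, qhPart p q k K z = 0)
    (hsign : SignDefinedOnCircle (qhPart p q (n + r) K)) {η : ℕ → ℝ}
    (hη : HasPoincareExpansion p q r X η) :
    η (n + 1) - (if n = 0 then 1 else 0) = 0 ↔
      ∀ φ : ℝ, qhPart p q (n + r) K (Real.cos φ, Real.sin φ) = 0 := by
  obtain ⟨κ, hκ, δ, hδ, C, hC, c, hc, hbd⟩ :=
    exists_integral_polarCofactor_bounds hp hq hX₁ hX₂ hX hmon hFK hKn hsign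
  obtain ⟨ε, hε, hret⟩ := hη
  have hT : (0 : ℝ) ≤ 2 * Real.pi := by positivity
  have hκ0 : 0 < κ := by linarith
  have hne : ¬ ∀ᶠ x in 𝓝 0, F (blowUp p q 0 x) = 0 := by
    refine not_eventually_eq_zero_on_section (r := r) hp hq hFK hκ
      (show 0 < min ε δ by positivity) fun ρ₀ hρ₀ => ?_
    obtain ⟨ρ₁, ⟨u, hu0, -, hu⟩, -⟩ := hret ρ₀ ⟨hρ₀.1, hρ₀.2.trans_le (min_le_left _ _)⟩
    obtain ⟨hb, L, hL, -⟩ := hbd u hu (by rw [hu0]; exact hρ₀.2.trans_le (min_le_right _ _))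
    exact ⟨u, hu, hu0, hb, L, hL⟩
  have hblow0 : blowUp p q 0 0 = (0, 0) := by simp [blowUp, hp.ne']
  obtain ⟨A, hA, δ', hδ', hdisp⟩ := exists_displacement_bounds
    (h := fun x => F (blowUp p q 0 x))
    (AnalyticAt.fun_comp (by rw [hblow0]; exact hFK.analytic_curve) (analyticAt_blowUp p q 0 0))
    (by rw [hblow0]; exact hFK.through_origin) hne hκ
  -- Coefficients of the displacement: `d i` belongs to `ρ^(i+1)`, and the identity map contributes
  -- only to `i = 0`.
  set d : ℕ → ℝ := fun i => η (i + 1) - (if i = 0 then 1 else 0) with hd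
  set D : ℝ → ℝ := fun ρ => ∑' i, d i * ρ ^ (i + 1) with hDdef
  have hsumD : ∀ ρ₀ ρ₁, HasSum (fun i : ℕ => η (i + 1) * ρ₀ ^ (i + 1)) ρ₁ →
      HasSum (fun i => d i * ρ₀ ^ (i + 1)) (ρ₁ - ρ₀) := by
    intro ρ₀ ρ₁ h
    have h1 : HasSum (fun i : ℕ => (if i = 0 then (1 : ℝ) else 0) * ρ₀ ^ (i + 1)) ρ₀ := by
      convert! hasSum_ite_eq 0 ρ₀ using 2 with i
      split_ifs with hi
      · simp [hi]
      · simp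
    refine (h.sub h1).congr_fun fun i => ?_
    simp only [hd]
    ring
  have hsum : ∀ ρ ∈ Set.Ioo 0 ε, HasSum (fun i => d i * ρ ^ (i + 1)) (D ρ) := by
    intro ρ hρ
    obtain ⟨ρ₁, -, h⟩ := hret ρ hρ
    exact (hsumD ρ ρ₁ h).summable.hasSum
  have hkey : ∀ᶠ ρ in 𝓝[>] 0, ∃ L : ℝ, (|L| ≤ A * (|D ρ| / ρ) ∧ |D ρ| ≤ A * (ρ * |L|)) ∧
      |L| ≤ C * ρ ^ n ∧
      ((∀ φ : ℝ, qhPart p q (n + r) K (Real.cos φ, Real.sin φ) = 0) → |L| ≤ C * ρ ^ (n + 1)) ∧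
      ((¬ ∀ φ : ℝ, qhPart p q (n + r) K (Real.cos φ, Real.sin φ) = 0) → c * ρ ^ n ≤ |L|) := by
    filter_upwards [Ioo_mem_nhdsGT (show 0 < min ε (min δ δ') by positivity)] with ρ hρ
    obtain ⟨ρ₁, ⟨u, hu0, hu1, hu⟩, hs⟩ := hret ρ ⟨hρ.1, hρ.2.trans_le (min_le_left _ _)⟩
    obtain ⟨hb, L, hL, hrest⟩ := hbd u hu
      (by rw [hu0]; exact hρ.2.trans_le ((min_le_right _ _).trans (min_le_left _ _)))
    have hend : (2 * Real.pi) ∈ Set.Icc 0 (2 * Real.pi) := ⟨hT, le_rfl⟩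
    have h1 := hb _ hend
    have h2 := hL _ hend
    -- The angles `0` and `2π` give the same half-axis, so both ends of the turn are values of the
    -- same function on the section.
    have h3 : blowUp p q (2 * Real.pi) ρ₁ = blowUp p q 0 ρ₁ := by simp [blowUp]
    rw [hu0] at hrest h1 h2
    rw [hu1] at h1 h2
    rw [h3] at h2
    have hDρ : D ρ = ρ₁ - ρ := (hsumD ρ ρ₁ hs).tsum_eq
    refine ⟨L (2 * Real.pi), ?_, hrest⟩
    rw [hDρ]
    exact hdisp ρ ρ₁ _ hρ.1 (hρ.2.trans_le ((min_le_right _ _).trans (min_le_right _ _)))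
      h1.1 h1.2 h2
  have hDup : ∀ᶠ ρ in 𝓝[>] 0, |D ρ| ≤ A * C * ρ ^ (n + 1) := by
    filter_upwards [hkey, self_mem_nhdsWithin] with ρ ⟨L, ⟨_, h1⟩, h2, _⟩ h3
    rw [Set.mem_Ioi] at h3
    calc |D ρ| ≤ A * (ρ * |L|) := h1
      _ ≤ A * (ρ * (C * ρ ^ n)) := by gcongr
      _ = _ := by ring
  constructor
  · intro h0
    by_contra hv
    -- From `c ρ^n ≤ |L| ≤ A |D| / ρ` the displacement is at least `(c / A) ρ^(n+1)`.
    refine coeff_ne_zero_of_le_abs hε hsum (c := c / A) (m := n) (by positivity) hDup ?_ h0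
    filter_upwards [hkey, self_mem_nhdsWithin] with ρ ⟨L, ⟨h1, _⟩, _, _, h2⟩ h3
    rw [Set.mem_Ioi] at h3
    have h4 := (h2 hv).trans h1
    rw [mul_div_assoc', le_div_iff₀ h3] at h4
    rw [div_mul_eq_mul_div, div_le_iff₀ hA, pow_succ, ← mul_assoc, mul_comm _ A]
    exact h4
  · intro hv
    -- One extra order in `L` gives `|D| = O(ρ^(n+2))`, which reaches the coefficient of index `n`.
    refine coeff_eq_zero_of_abs_le hε hsum (C := A * C) (m := n + 1) ?_ n (Nat.lt_succ_self n)
    filter_upwards [hkey, self_mem_nhdsWithin] with ρ ⟨L, ⟨_, h1⟩, _, h2, _⟩ h3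
    rw [Set.mem_Ioi] at h3
    calc |D ρ| ≤ A * (ρ * |L|) := h1
      _ ≤ A * (ρ * (C * ρ ^ (n + 1))) := by
        gcongr
        exact h2 hv
      _ = _ := by ring

end

theorem mainTheorem6 {m : ℕ} (Λ Λhat : Set (EuclideanSpace ℝ (Fin m))) (hsub : Λhat ⊆ Λ)
    (p q r rbar : ℕ) (hr : 1 ≤ r)
    (X : EuclideanSpace ℝ (Fin m) → ℝ × ℝ → ℝ × ℝ)
    (hX : ∀ l ∈ Λ,
      AnalyticAt ℝ (fun w : EuclideanSpace ℝ (Fin m) × (ℝ × ℝ) => X w.1 w.2) (l, (0, 0)))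
    (hMo : ∀ l ∈ Λ, InMonodromicClass p q r (X l))
    (F K : EuclideanSpace ℝ (Fin m) → ℝ × ℝ → ℝ)
    (hFK : ∀ l ∈ Λ, IsInvariantCurve (X l) (F l) (K l))
    (hK : ∀ l ∈ Λ, ∀ k < rbar, ∀ z, qhPart p q k (K l) z = 0)
    (hsign : ∀ l ∈ Λ, SignDefinedOnCircle (qhPart p q rbar (K l)))
    (hvanish : ∀ l ∈ Λ,
      (∀ φ : ℝ, qhPart p q rbar (K l) (Real.cos φ, Real.sin φ) = 0) ↔ l ∈ Λhat) :
    (∀ l ∈ Λ, ∃ η : ℕ → ℝ, HasPoincareExpansion p q r (X l) η) ∧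
    ∀ η : EuclideanSpace ℝ (Fin m) → ℕ → ℝ,
      (∀ l ∈ Λ, HasPoincareExpansion p q r (X l) (η l)) →
      (rbar = r → {l | l ∈ Λ ∧ η l 1 = 1} = Λhat) ∧
      (r < rbar → {l | l ∈ Λ ∧ η l (rbar - r + 1) = 0} = Λhat) := by
  have hXl : ∀ l ∈ Λ, AnalyticAt ℝ (X l) (0, 0) := fun l hl =>
    AnalyticAt.fun_comp (f := fun z : ℝ × ℝ => (l, z)) (hX l hl) (by fun_prop)
  have hX₁ : ∀ l ∈ Λ, AnalyticAt ℝ (fun w => (X l w).1) (0, 0) := fun l hl =>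
    analyticAt_fst.comp (hXl l hl)
  have hX₂ : ∀ l ∈ Λ, AnalyticAt ℝ (fun w => (X l w).2) (0, 0) := fun l hl =>
    analyticAt_snd.comp (hXl l hl)
  have hp : ∀ l ∈ Λ, 0 < p := fun l hl => (hMo l hl).weights.1
  have hq : ∀ l ∈ Λ, 0 < q := fun l hl => (hMo l hl).weights.2.1
  refine ⟨fun l hl => exists_hasPoincareExpansion (hp l hl) (hq l hl) (hX₁ l hl) (hX₂ l hl)
    (hMo l hl).expansion (hMo l hl).monodromic, fun η hη => ?_⟩
  -- Both cases are this one statement with `n = rbar - r`; the subtracted `1` survives only for `n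
  -- = 0`.
  have hmain : ∀ n, rbar = n + r → ∀ l ∈ Λ,
      (η l (n + 1) - (if n = 0 then 1 else 0) = 0 ↔ l ∈ Λhat) := by
    rintro n rfl l hl
    rw [← hvanish l hl]
    exact displacement_coeff_eq_zero_iff (hp l hl) (hq l hl) (hX₁ l hl) (hX₂ l hl)
      (hMo l hl).expansion (hMo l hl).monodromic (hFK l hl) (hK l hl) (hsign l hl) (hη l hl)
  constructor
  · intro hrr
    ext l
    refine ⟨fun h => (hmain 0 (by omega) l h.1).1 (by simp [h.2]), fun h => ⟨hsub h, ?_⟩⟩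
    have := (hmain 0 (by omega) l (hsub h)).2 h
    simpa [sub_eq_zero] using this
  · intro hrr
    have hn : rbar - r ≠ 0 := by omega
    ext l
    refine ⟨fun h => (hmain (rbar - r) (by omega) l h.1).1 (by simp [h.2, hn]),
      fun h => ⟨hsub h, ?_⟩⟩
    have := (hmain (rbar - r) (by omega) l (hsub h)).2 h
    simpa [hn] using this
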